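/- Write $e(x)=e^{2\pi i x}$. Let $\Gamma_\theta=\{\begin{pmatrix}a&b\\c&d\end{pmatrix}\in SL(2,\mathbb Z): ab\equiv cd\equiv 0 \bmod 2\}$ and, for a positive integer $N$, let $\Gamma_\theta(4N)=\{\begin{pmatrix}a&b\\c&d\end{pmatrix}\in SL(2,\mathbb Z/4N\mathbb Z): ab\equiv cd\equiv 0 \bmod 2\}$. Let $\mathcal H_N=L^2(\mathbb Z/N\mathbb Z)$. For $A=\begin{pmatrix}a&b\\c&d\end{pmatrix}\in\Gamma_\theta$ define an operator $U_N(A)$ on $\mathcal H_N$ as follows (in each formula $Q,Q'$ are taken in $\{0,\dots,N-1\}$). (i) If $b=0$ (so $a=d=\pm1$), $[U_N(A)\Phi](Q)=e\!\left(\frac{acQ^2}{2N}\right)\Phi(aQ)$. (ii) If $a=0$ (so $b=-c=\pm1$), $[U_N(A)\Phi](Q)=\frac1{\sqrt N}\sum_{Q' \bmod N}e\!\left(\frac{b}{2N}(dQ^2-2QQ')\right)\Phi(Q')$. (iii) If $a\ne0$ and $b\neq 0$, put $N_b=N/(b,N)$, $b'=b/(b,N)$ with $(b,N)>0$ the greatest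 common divisor, and $$[U_N(A)\Phi](Q)=\frac{h(a,b)}{\sqrt{N_b}}\sum_{Q' \bmod N}G\!\left(N_ba,\,b',\,\tfrac{2(aQ'-Q)}{(b,N)}\right)e\!\left(\frac{dQ^2-2QQ'+aQ'^2}{2Nb}\right)\Phi(Q'),$$ where, with Jacobi symbols, $h(a,b)=\left(\frac{|a|}{|b|}\right)e(\mathrm{sign}(ab)(|b|-1)/8)$ if $a$ is even, $h(a,b)=\left(\frac{|b|}{|a|}\right)e(-\mathrm{sign}(ab)|a|/8)$ if $a$ is odd, and $$G(\alpha,\beta,\gamma)=\frac1{\sqrt{|\beta|}}\sum_{k \bmod |\beta|}e\!\left(\frac{\alpha k^2+\gamma k}{2\beta}\right)$$ if $\gamma$ is an integer and $\alpha\beta+\gamma$ is even, and $G(\alpha,\beta,\gamma)=0$ otherwise. Then for every positive integer $N$: 1. $U_N(A)$ depends only on the reduction of $A$ modulo $4N$: if $A,B\in\Gamma_\theta$ and $A\equiv B \bmod 4N$, then $U_N(A)=U_N(B)$. 2. Hence the $U_N(A)$ define a proper (not merely projective) unitary representation of $\Gamma_\theta(4N)$: there is a unique group homomorphism $\rho$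 from $\Gamma_\theta(4N)$ to the unitary group of $\mathcal H_N$ such that $\rho(A \bmod 4N)=U_N(A)$ for all $A\in\Gamma_\theta$. 3. In particular, if $A\in\Gamma_\theta$ and $A\equiv \begin{pmatrix}1&0\\0&1\end{pmatrix}\bmod 4N$, then $U_N(A)=\left(\frac{N}{|a|}\right)\mathrm{Id}$ and $\left(\frac{N}{|a|}\right)=1$. -/

import Mathlib

open scoped MatrixGroups

noncomputable section

namespace CatMap

/-- The theta subgroup of `SL(2, R)`: the matrices `(a b; c d)` with `ab ≡ cd ≡ 0 mod 2`.
For `R = ℤ` it is the theta group `Γ_θ`, for `R = ℤ/4Nℤ` it is `Γ_θ(4N)`. -/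
def thetaGroup (R : Type*) [CommRing R] : Subgroup SL(2, R) where
  carrier := {A | (2 : R) ∣ A 0 0 * A 0 1 ∧ (2 : R) ∣ A 1 0 * A 1 1}
  one_mem' := by simp
  mul_mem' := by
    rintro A B ⟨⟨x, hx⟩, y, hy⟩ ⟨⟨z, hz⟩, w, hw⟩
    refine ⟨⟨A 0 0 ^ 2 * z + A 0 1 ^ 2 * w + x * (B 0 0 * B 1 1 + B 0 1 * B 1 0), ?_⟩,
      ⟨A 1 0 ^ 2 * z + A 1 1 ^ 2 * w + y * (B 0 0 * B 1 1 + B 0 1 * B 1 0), ?_⟩⟩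
    · simp only [Matrix.SpecialLinearGroup.coe_mul, Matrix.mul_apply, Fin.sum_univ_two]
      linear_combination (A 0 0 ^ 2) * hz + (A 0 1 ^ 2) * hw
        + (B 0 0 * B 1 1 + B 0 1 * B 1 0) * hx
    · simp only [Matrix.SpecialLinearGroup.coe_mul, Matrix.mul_apply, Fin.sum_univ_two]
      linear_combination (A 1 0 ^ 2) * hz + (A 1 1 ^ 2) * hw
        + (B 0 0 * B 1 1 + B 0 1 * B 1 0) * hy
  inv_mem' := by
    rintro A ⟨⟨x, hx⟩, y, hy⟩
    have hdet : A 0 0 * A 1 1 - A 0 1 * A 1 0 = 1 := by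
      rw [← Matrix.det_fin_two, A.det_coe]
    refine ⟨⟨A 0 1 ^ 2 * y - A 1 1 ^ 2 * x, ?_⟩, ⟨A 1 0 ^ 2 * x - A 0 0 ^ 2 * y, ?_⟩⟩
    · simp only [Matrix.SpecialLinearGroup.SL2_inv_expl, Matrix.cons_val_zero,
        Matrix.cons_val_one, Matrix.cons_val', Matrix.cons_val_fin_one]
      linear_combination (A 0 1 * A 1 1) * hdet - (A 1 1 ^ 2) * hx + (A 0 1 ^ 2) * hy
    · simp only [Matrix.SpecialLinearGroup.SL2_inv_expl, Matrix.cons_val_zero,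
        Matrix.cons_val_one, Matrix.cons_val', Matrix.cons_val_fin_one]
      linear_combination (A 0 0 * A 1 0) * hdet + (A 1 0 ^ 2) * hx - (A 0 0 ^ 2) * hy

/-- The projection `Γ_θ → Γ_θ(4N)`, reduction of the entries modulo `4N`. -/
def thetaReduction (N : ℕ) : thetaGroup ℤ →* thetaGroup (ZMod (4 * N)) :=
  ((Matrix.SpecialLinearGroup.map (Int.castRingHom (ZMod (4 * N)))).comp
    (thetaGroup ℤ).subtype).codRestrict (thetaGroup (ZMod (4 * N))) (by
      rintro ⟨A, ⟨x, hx⟩, y, hy⟩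
      refine ⟨⟨(x : ZMod (4 * N)), ?_⟩, ⟨(y : ZMod (4 * N)), ?_⟩⟩
      · have := congrArg (Int.cast : ℤ → ZMod (4 * N)) hx
        push_cast at this
        simpa using this
      · have := congrArg (Int.cast : ℤ → ZMod (4 * N)) hy
        push_cast at this
        simpa using this)

/-- The Hilbert space `L²(ℤ/Nℤ)` of dimension `N`. -/
abbrev Hilb (N : ℕ) : Type := EuclideanSpace ℂ (ZMod N)

/-- `e(x) = exp(2πix)`. -/
def e (x : ℝ) : ℂ := Complex.exp (2 * Real.pi * Complex.I * x)

/-- The phase factor `h(a, b)`, with the Jacobi symbols `(|a| / |b|)` and `(|b| / |a|)`. -/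
def hPhase (a b : ℤ) : ℂ :=
  if Even a then
    (jacobiSym |a| b.natAbs : ℂ) * e (((a * b).sign : ℝ) * ((b.natAbs : ℝ) - 1) / 8)
  else
    (jacobiSym |b| a.natAbs : ℂ) * e (-((a * b).sign : ℝ) * (a.natAbs : ℝ) / 8)

open Classical in
/-- The normalized Gauss sum
`G(α, β, γ) = |β|^(-1/2) ∑_{k mod |β|} e((α k² + γ k) / (2β))`.
The summand is a function of `k` modulo `|β|` exactly if `γ` is an integer and `αβ + γ` is even;
otherwise the sum over residue classes is given the value `0`. -/
def normGaussSum (α β : ℤ) (γ : ℝ) : ℂ :=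
  if ∃ g : ℤ, γ = g ∧ Even (α * β + g) then
    1 / (Real.sqrt (β.natAbs : ℝ) : ℂ) *
      ∑ k ∈ Finset.range β.natAbs,
        e (((α : ℝ) * (k : ℝ) ^ 2 + γ * (k : ℝ)) / (2 * (β : ℝ)))
  else 0

/-- The kernel of the propagator with `a ≠ 0` and `b ≠ 0`:
`h(a,b) / √N_b * G(N_b a, b', 2(aQ' - Q)/(b,N)) * e((dQ² - 2QQ' + aQ'²) / (2Nb))`,
where `N_b = N/(b,N)` and `b' = b/(b,N)`. -/
def kernel (N : ℕ) (a b d : ℤ) (Q Q' : ℤ) : ℂ :=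
  hPhase a b / (Real.sqrt ((N / Int.gcd b N : ℕ) : ℝ) : ℂ) *
    normGaussSum ((N / Int.gcd b N : ℕ) * a) (b / (Int.gcd b N : ℤ))
      (2 * ((a : ℝ) * Q' - Q) / (Int.gcd b N : ℝ)) *
    e (((d : ℝ) * (Q : ℝ) ^ 2 - 2 * Q * Q' + a * (Q' : ℝ) ^ 2) / (2 * N * b))

/-- The function `Q ↦ [U_N(A) Φ](Q)` for `A = (a b; c d)`, classes modulo `N` being
represented by the integers `0, …, N - 1`.

* If `b = 0`, then `a = d = ±1` and the value is `e(±c Q² / (2N)) Φ(±Q)`;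
  for `c = 0` and `a = -1` this is the parity operator.
* If `a = 0`, then `b = -c = ±1` and the value is
  `N^(-1/2) ∑_{Q'} e(±(d Q² - 2QQ') / (2N)) Φ(Q')`; for `d = 0` this is the discrete Fourier
  transform, with the sign `+` in the exponential `e(QQ'/N)` for `b = -1`. -/
def propagatorFun (N : ℕ) [NeZero N] (a b c d : ℤ) (Φ : ZMod N → ℂ) (Q : ZMod N) : ℂ :=
  if b = 0 then
    e ((a : ℝ) * c * (Q.val : ℝ) ^ 2 / (2 * N)) * Φ ((a : ZMod N) * Q)
  else if a = 0 then
    1 / (Real.sqrt (N : ℝ) : ℂ) *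
      ∑ Q' : ZMod N,
        e ((b : ℝ) / (2 * N) * ((d : ℝ) * (Q.val : ℝ) ^ 2 - 2 * (Q.val : ℝ) * (Q'.val : ℝ))) *
          Φ Q'
  else
    ∑ Q' : ZMod N, kernel N a b d (Q.val : ℤ) (Q'.val : ℤ) * Φ Q'

/-- The propagator `U_N(A)`, a linear operator on `L²(ℤ/Nℤ)`, for `A` in the theta group. -/
def propagator (N : ℕ) [NeZero N] (A : thetaGroup ℤ) : Hilb N →ₗ[ℂ] Hilb N where
  toFun Φ := WithLp.toLp 2
    (propagatorFun N (A.1 0 0) (A.1 0 1) (A.1 1 0) (A.1 1 1) (fun Q => Φ Q))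
  map_add' Φ Ψ := by
    ext Q
    simp only [propagatorFun, PiLp.add_apply]
    split_ifs <;> simp only [mul_add, Finset.sum_add_distrib]
  map_smul' r Φ := by
    ext Q
    simp only [propagatorFun, PiLp.smul_apply, smul_eq_mul, RingHom.id_apply]
    split_ifs
    · ring
    · simp only [Finset.mul_sum]
      exact Finset.sum_congr rfl fun _ _ => by ring
    · simp only [Finset.mul_sum]
      exact Finset.sum_congr rfl fun _ _ => by ring

end CatMap

end

/-! For $b\ne0$ the divisibility conditions in the kernel disappear once $Q'$ is lifted to residues
modulo $N|b|$: $U_N(A)$ is $h(a,b)/\sqrt{N|b|}$ times the sum of $e((dQ^2-2Qx+ax^2)/(2Nb))\,\Phi(x)$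
over $x$ modulo $N|b|$ (`kernel_eq`, `propagatorFun_eq`). The exponent is the generating function of
the linear map $A$, so this kernel intertwines phase space translations
(`quadraticPhase_translate`).

The phases make $U_N$ multiplicative. The group $\Gamma_\theta$ is generated by
$F=\begin{pmatrix}0&-1\\1&0\end{pmatrix}$ and the lower triangular matrices (`thetaGroup_induction`,
a Euclidean algorithm with even quotients), so left multiplication by these suffices. Lower
triangular matrices only multiply by a phase and possibly reflect. For $F$, the Fourier transform of
the kernel is a Gauss sum with a linear term. Landsberg–Schaar reciprocity (`landsbergSchaar`) turns
it into the kernel of $FA$ times an eighth root of unity. This root matches the change of $h$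
because $h(a,b)$ is the inverse of the normalized Gauss sum $|b|^{-1/2}\sum_k e(ak^2/(2b))$
(`hPhase_mul_quadraticSum`). Reciprocity itself comes from Poisson summation for a theta series
approaching the rational point $d/m$ of the boundary.

Unitarity is also checked on generators. If $A\equiv1$ modulo $4N$, the intertwining relation forces
$U_N(A)$ to be a scalar; its value on the basis vector at $0$ is a Gauss sum, which $h$ reduces to
$(N/|a|)$, and this is $1$ because $a\equiv1$ modulo $4N$ (`propagator_of_congr_one`,
`jacobiSym_of_modEq_one`). So the kernel of reduction acts trivially. As reduction is surjective
onto $\Gamma_\theta(4N)$ (`thetaReduction_surjective`), the representation descends uniquely. -/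

namespace CatMap

/-! ### The character $e(x)$. -/

section Exponential

lemma e_add (x y : ℝ) : e (x + y) = e x * e y := by
  simp only [e, ← Complex.exp_add]
  congr 1
  push_cast
  ring

lemma e_zero : e 0 = 1 := by simp [e]

lemma e_intCast (n : ℤ) : e n = 1 := by
  rw [e, Complex.exp_eq_one_iff]
  exact ⟨n, by push_cast; ring⟩

lemma e_congr {x y : ℝ} (n : ℤ) (h : x - y = n) : e x = e y := by
  rw [show x = y + n by linarith, e_add, e_intCast, mul_one]

lemma e_eq_one {x : ℝ} (n : ℤ) (h : x = n) : e x = 1 := by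
  rw [h, e_intCast]

lemma e_eq_one_iff (x : ℝ) : e x = 1 ↔ ∃ n : ℤ, x = n := by
  refine ⟨fun h => ?_, fun ⟨n, h⟩ => e_eq_one n h⟩
  rw [e, Complex.exp_eq_one_iff] at h
  obtain ⟨n, hn⟩ := h
  refine ⟨n, ?_⟩
  have h2 : (2 * Real.pi * Complex.I : ℂ) ≠ 0 := Complex.two_pi_I_ne_zero
  have : (x : ℂ) = n := by
    apply mul_left_cancel₀ h2
    linear_combination hn
  exact_mod_cast this

lemma norm_e (x : ℝ) : ‖e x‖ = 1 := by
  rw [e, show (2 * Real.pi * Complex.I * x : ℂ) = ((2 * Real.pi * x : ℝ) : ℂ) * Complex.I by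
    push_cast; ring, Complex.norm_exp_ofReal_mul_I]

lemma conj_e (x : ℝ) : (starRingEnd ℂ) (e x) = e (-x) := by
  rw [e, e, ← Complex.exp_conj]
  congr 1
  simp [Complex.conj_ofNat]

lemma e_neg_mul (x : ℝ) : e (-x) * e x = 1 := by
  rw [← e_add, neg_add_cancel, e_zero]

lemma e_nat_mul (n : ℕ) (x : ℝ) : e (n * x) = e x ^ n := by
  rw [e, e, ← Complex.exp_nat_mul]
  congr 1
  push_cast
  ring

end Exponential

/-! ### Sums of periodic functions over residues. -/

section ResidueSum

/-- The sum of `f` over the residues `0, …, n - 1`. -/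
def residueSum (n : ℕ) (f : ℤ → ℂ) : ℂ := ∑ k ∈ Finset.range n, f k

lemma periodic_of_dvd {n : ℤ} {f : ℤ → ℂ} (hf : Function.Periodic f n) {x y : ℤ}
    (h : n ∣ x - y) : f x = f y := by
  obtain ⟨k, hk⟩ := h
  have := hf.int_mul k y
  rw [← this]
  congr 1
  simp only [Int.cast_id]
  linarith

lemma residueSum_congr {n : ℕ} {f g : ℤ → ℂ} (h : ∀ k, f k = g k) :
    residueSum n f = residueSum n g := by
  rw [show f = g from funext h]

lemma residueSum_const_mul (n : ℕ) (c : ℂ) (f : ℤ → ℂ) :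
    residueSum n (fun k => c * f k) = c * residueSum n f := by
  simp only [residueSum, Finset.mul_sum]

lemma residueSum_mul_const (n : ℕ) (c : ℂ) (f : ℤ → ℂ) :
    residueSum n (fun k => f k * c) = residueSum n f * c := by
  simp only [residueSum, Finset.sum_mul]

lemma residueSum_comm (m n : ℕ) (f : ℤ → ℤ → ℂ) :
    residueSum m (fun x => residueSum n (fun y => f x y)) =
      residueSum n (fun y => residueSum m (fun x => f x y)) :=
  Finset.sum_comm

lemma residueSum_one (f : ℤ → ℂ) : residueSum 1 f = f 0 := by
  simp [residueSum]

lemma conj_residueSum (n : ℕ) (f : ℤ → ℂ) :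
    (starRingEnd ℂ) (residueSum n f) = residueSum n (fun k => (starRingEnd ℂ) (f k)) := by
  simp [residueSum, map_sum]

lemma sum_zmod_val (n : ℕ) [NeZero n] (f : ℤ → ℂ) :
    ∑ x : ZMod n, f (x.val : ℤ) = residueSum n f := by
  rw [residueSum]
  refine Finset.sum_bij' (fun x _ => x.val) (fun k _ => (k : ZMod n)) ?_ ?_ ?_ ?_ ?_
  · intro x _
    simpa using ZMod.val_lt x
  · simp
  · simp
  · intro k hk
    exact ZMod.val_cast_of_lt (by simpa using hk)
  · simp

/-- A sum over `ℤ/nℤ` of a function pulled back to the integers. -/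
lemma sum_zmod_eq (n : ℕ) [NeZero n] (F : ZMod n → ℂ) :
    ∑ x : ZMod n, F x = residueSum n (fun k => F (k : ZMod n)) := by
  rw [← sum_zmod_val]
  simp

lemma periodic_val {n : ℕ} [NeZero n] {f : ℤ → ℂ} (hf : Function.Periodic f n) (k : ℤ) :
    f ((k : ZMod n).val : ℤ) = f k := by
  apply periodic_of_dvd hf
  rw [← ZMod.intCast_zmod_eq_zero_iff_dvd]
  simp

/-- Affine substitution in a sum over residues. -/
lemma residueSum_affine {n : ℕ} {f : ℤ → ℂ} (hf : Function.Periodic f n) {u : ℤ}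
    (hu : IsCoprime u n) (v : ℤ) :
    residueSum n (fun k => f (u * k + v)) = residueSum n f := by
  rcases Nat.eq_zero_or_pos n with rfl | hn
  · simp [residueSum]
  have : NeZero n := ⟨hn.ne'⟩
  set F : ZMod n → ℂ := fun x => f (x.val : ℤ) with hF
  have hFk : ∀ k : ℤ, F (k : ZMod n) = f k := fun k => periodic_val hf k
  have h1 : residueSum n f = ∑ x, F x := (sum_zmod_val n f).symm
  have h2 : residueSum n (fun k => f (u * k + v)) = ∑ x, F ((u : ZMod n) * x + v) := by
    rw [sum_zmod_eq]
    refine residueSum_congr fun k => ?_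
    rw [← hFk]
    push_cast
    rfl
  rw [h1, h2]
  have hinj : Function.Injective (fun x : ZMod n => (u : ZMod n) * x + v) := by
    intro x y hxy
    simp only [add_left_inj] at hxy
    obtain ⟨s, t, hst⟩ := hu
    have hs : (s : ZMod n) * u = 1 := by
      have := congrArg (Int.cast : ℤ → ZMod n) hst
      push_cast at this
      simpa using this
    calc x = (s * u) * x := by rw [hs, one_mul]
      _ = (s * u) * y := by rw [mul_assoc, hxy, mul_assoc]
      _ = y := by rw [hs, one_mul]
  exact (Finite.injective_iff_bijective.mp hinj).sum_comp F

lemma residueSum_add {n : ℕ} {f : ℤ → ℂ} (hf : Function.Periodic f n) (v : ℤ) :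
    residueSum n (fun k => f (k + v)) = residueSum n f := by
  simpa using residueSum_affine hf isCoprime_one_left v

/-- Splitting the residues modulo `m * n` by their class modulo `m`. -/
lemma residueSum_mul (m n : ℕ) (f : ℤ → ℂ) :
    residueSum (m * n) f = residueSum m (fun i => residueSum n (fun j => f (i + m * j))) := by
  rcases Nat.eq_zero_or_pos m with rfl | hm
  · simp [residueSum]
  rw [residueSum_comm]
  simp only [residueSum]
  induction n with
  | zero => simp
  | succ n ih =>
    rw [Nat.mul_succ, Finset.sum_range_add, ih, Finset.sum_range_succ]
    congr 1
    refine Finset.sum_congr rfl fun i _ => ?_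
    congr 1
    push_cast
    ring

/-- Extending a sum of an `n`-periodic function to `n * m` residues. -/
lemma residueSum_extend (n m : ℕ) {f : ℤ → ℂ} (hf : Function.Periodic f n) :
    residueSum (n * m) f = m * residueSum n f := by
  rw [residueSum_mul, residueSum_comm]
  have : ∀ j : ℤ, residueSum n (fun i => f (i + n * j)) = residueSum n f := by
    intro j
    refine residueSum_congr fun i => periodic_of_dvd hf ⟨j, by ring⟩
  rw [residueSum_congr this]
  simp [residueSum]

end ResidueSum

/-! ### Landsberg–Schaar reciprocity from the asymptotics of theta series. -/

section LandsbergSchaar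

open Filter Topology Complex

lemma ofReal_mul_cpow {r : ℝ} (hr : 0 < r) {z : ℂ} (hz : z ≠ 0) (s : ℂ) :
    ((r : ℂ) * z) ^ s = (r : ℂ) ^ s * z ^ s := by
  have hr' : (r : ℂ) ≠ 0 := by exact_mod_cast hr.ne'
  rw [cpow_def_of_ne_zero (mul_ne_zero hr' hz), cpow_def_of_ne_zero hr', cpow_def_of_ne_zero hz,
    log_ofReal_mul hr hz, ← exp_add, ofReal_log hr.le]
  ring_nf

lemma norm_cexp_quadratic (a : ℂ) (s : ℝ) (n : ℤ) :
    ‖cexp (-Real.pi * a * n ^ 2 + 2 * Real.pi * (-I * s) * n)‖ =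
      Real.exp (-Real.pi * a.re * n ^ 2) := by
  rw [norm_exp]
  congr 1
  have h1 : (-Real.pi * a * n ^ 2 + 2 * Real.pi * (-I * s) * n : ℂ) =
      ((-Real.pi * n ^ 2 : ℝ) : ℂ) * a + ((-2 * Real.pi * s * n : ℝ) : ℂ) * I := by
    push_cast; ring
  rw [h1, add_re, re_ofReal_mul, re_ofReal_mul, I_re]
  ring

lemma summable_exp_neg_sq {r : ℝ} (hr : 0 < r) :
    Summable (fun n : ℤ => Real.exp (-Real.pi * r * (n : ℝ) ^ 2)) := by
  have h := summable_pow_mul_jacobiTheta₂_term_bound 0 hr 0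
  refine h.congr fun n => ?_
  simp only [pow_zero, one_mul]
  congr 1
  ring

/-- As the real part of $a$ grows, only the term $n=0$ survives; the series at real part $1$
dominates. -/
lemma tendsto_tsum_quadratic {ι : Type*} {l : Filter ι} [l.IsCountablyGenerated] (a : ι → ℂ)
    (ha : Tendsto (fun i => (a i).re) l atTop) (s : ℝ) :
    Tendsto (fun i => ∑' n : ℤ, cexp (-Real.pi * a i * n ^ 2 + 2 * Real.pi * (-I * s) * n)) l
      (𝓝 1) := by
  have key : Tendsto (fun i => ∑' n : ℤ,
      cexp (-Real.pi * a i * n ^ 2 + 2 * Real.pi * (-I * s) * n)) l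
      (𝓝 (∑' n : ℤ, if n = 0 then (1 : ℂ) else 0)) := by
    refine tendsto_tsum_of_dominated_convergence (summable_exp_neg_sq one_pos) ?_ ?_
    · intro n
      rcases eq_or_ne n 0 with rfl | hn
      · simpa using tendsto_const_nhds
      · simp only [hn, if_false]
        rw [tendsto_zero_iff_norm_tendsto_zero]
        simp only [norm_cexp_quadratic]
        refine Real.tendsto_exp_atBot.comp ?_
        have hpos : 0 < Real.pi * (n : ℝ) ^ 2 := by positivity
        have := (ha.const_mul_atTop hpos)
        refine (tendsto_neg_atTop_atBot.comp this).congr fun i => ?_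
        simp only [Function.comp]
        ring
    · filter_upwards [ha.eventually_ge_atTop 1] with i hi n
      rw [norm_cexp_quadratic]
      apply Real.exp_le_exp.mpr
      have : 0 ≤ Real.pi * (n : ℝ) ^ 2 := by positivity
      nlinarith
  simpa using key

lemma re_pos_of_inv {w : ℂ} (h : 0 < (w⁻¹).re) : 0 < w.re := by
  rw [inv_re] at h
  by_contra hw
  exact absurd h (not_lt.mpr (div_nonpos_of_nonpos_of_nonneg (not_lt.mp hw) (normSq_nonneg _)))

/-- Poisson summation, turning a wide shifted Gaussian into a narrow one with a character. -/
lemma sqrt_mul_tsum_gaussian {w : ℂ} (hw : 0 < (w⁻¹).re) (s : ℝ) :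
    w ^ (1 / 2 : ℂ) * ∑' n : ℤ, cexp (-Real.pi * w * (n + s) ^ 2) =
      ∑' n : ℤ, cexp (-Real.pi * w⁻¹ * n ^ 2 + 2 * Real.pi * (-I * s) * n) := by
  rw [Complex.tsum_exp_neg_quadratic hw]
  have harg : w.arg ≠ Real.pi := by
    intro h
    have := (arg_eq_pi_iff.mp h).1
    exact absurd (re_pos_of_inv hw) (not_lt.mpr this.le)
  rw [inv_cpow _ _ harg, one_div (w ^ (1 / 2 : ℂ))⁻¹, inv_inv]
  congr 2
  funext n
  rw [div_inv_eq_mul]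
  have : I * (-I * s) = (s : ℂ) := by linear_combination (-(s : ℂ)) * I_sq
  rw [this]

lemma tendsto_sqrt_mul_tsum_gaussian {ι : Type*} {l : Filter ι} [l.IsCountablyGenerated]
    (w : ι → ℂ) (hw : Tendsto (fun i => ((w i)⁻¹).re) l atTop) (s : ℝ) :
    Tendsto (fun i => w i ^ (1 / 2 : ℂ) * ∑' n : ℤ, cexp (-Real.pi * w i * (n + s) ^ 2)) l
      (𝓝 1) := by
  refine (tendsto_tsum_quadratic (fun i => (w i)⁻¹) hw s).congr' ?_
  filter_upwards [hw.eventually_gt_atTop 0] with i hi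
  rw [sqrt_mul_tsum_gaussian hi]

lemma summable_gaussian {w : ℂ} (hw : 0 < w.re) (s : ℝ) :
    Summable (fun n : ℤ => cexp (-Real.pi * w * (n + s) ^ 2)) := by
  have h := (summable_jacobiTheta₂_term_iff (w * s * I) (w * I)).mpr (by simpa using hw)
  refine (h.mul_left (cexp (-Real.pi * w * s ^ 2))).congr fun n => ?_
  rw [jacobiTheta₂_term, ← exp_add]
  congr 1
  linear_combination (2 * Real.pi * w * s * n + Real.pi * w * n ^ 2) * I_sq

lemma norm_periodic_bounded {M : ℕ} [NeZero M] {c : ℤ → ℂ} (hc : Function.Periodic c M) :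
    ∃ C, ∀ n, ‖c n‖ ≤ C := by
  refine ⟨∑ x : ZMod M, ‖c (x.val : ℤ)‖, fun n => ?_⟩
  rw [← periodic_val hc n]
  exact Finset.single_le_sum (f := fun x : ZMod M => ‖c (x.val : ℤ)‖)
    (fun _ _ => norm_nonneg _) (Finset.mem_univ _)

lemma exists_equiv_mul_add (M : ℕ) [NeZero M] :
    ∃ E : Fin M × ℤ ≃ ℤ, ∀ (r : Fin M) (m : ℤ), E (r, m) = M * m + ((r : ℕ) : ℤ) := by
  refine ⟨(Equiv.prodComm (Fin M) ℤ).trans (Int.divModEquiv M).symm, fun r m => ?_⟩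
  rw [Equiv.trans_apply, Equiv.prodComm_apply, Prod.swap_prod_mk, Int.divModEquiv_symm_apply]
  ring

lemma tsum_periodic_mul {M : ℕ} [NeZero M] {c g : ℤ → ℂ} (hc : Function.Periodic c M)
    (hg : Summable g) :
    ∑' n, c n * g n = residueSum M (fun r => c r * ∑' m : ℤ, g (M * m + r)) := by
  obtain ⟨C, hC⟩ := norm_periodic_bounded hc
  have hs : Summable (fun n => c n * g n) := by
    refine Summable.of_norm_bounded (hg.norm.mul_left C) fun n => ?_
    rw [norm_mul]
    exact mul_le_mul_of_nonneg_right (hC n) (norm_nonneg _)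
  obtain ⟨E, hE⟩ := exists_equiv_mul_add M
  have hs' : Summable (fun p : Fin M × ℤ => c (E p) * g (E p)) := E.summable_iff.mpr hs
  calc ∑' n, c n * g n = ∑' p : Fin M × ℤ, c (E p) * g (E p) :=
        (E.tsum_eq (fun n => c n * g n)).symm
    _ = ∑ r : Fin M, ∑' m : ℤ, c (E (r, m)) * g (E (r, m)) := by
        rw [hs'.tsum_prod, tsum_fintype]
    _ = ∑ r : Fin M, c (r : ℕ) * ∑' m : ℤ, g (M * m + (r : ℕ)) := by
        refine Finset.sum_congr rfl fun r _ => ?_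
        rw [← tsum_mul_left]
        refine tsum_congr fun m => ?_
        rw [hE]
        congr 1
        exact periodic_of_dvd hc ⟨m, by ring⟩
    _ = _ := by rw [residueSum, Finset.sum_range]

/-- A wide Gaussian averages a periodic weight: each class $n=Mm+r$ carries a Gaussian of parameter
$M^2w$, and the factor $(M^2)^{1/2}$ accounts for its share $1/M$. The hypothesis is on the real
part of $1/w$ so that complex $w$ tending to $0$ is allowed. -/
lemma tendsto_sqrt_mul_tsum_periodic {ι : Type*} {l : Filter ι} [l.IsCountablyGenerated]
    (w : ι → ℂ) (hw : Tendsto (fun i => ((w i)⁻¹).re) l atTop) (s : ℝ) {M : ℕ} [NeZero M]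
    {c : ℤ → ℂ} (hc : Function.Periodic c M) :
    Tendsto (fun i => w i ^ (1 / 2 : ℂ) * ∑' n : ℤ, c n * cexp (-Real.pi * w i * (n + s) ^ 2)) l
      (𝓝 (residueSum M c / M)) := by
  have hM : (0 : ℝ) < M := by exact_mod_cast NeZero.pos M
  have hM' : (M : ℂ) ≠ 0 := by exact_mod_cast hM.ne'
  have hlim : ∀ r : ℕ, Tendsto (fun i => c r * (((M ^ 2 : ℝ) * w i) ^ (1 / 2 : ℂ) *
      ∑' n : ℤ, cexp (-Real.pi * ((M ^ 2 : ℝ) * w i) * (n + ((r + s) / M : ℝ)) ^ 2)) / M) l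
      (𝓝 (c r * 1 / M)) := by
    intro r
    refine ((tendsto_sqrt_mul_tsum_gaussian (fun i => ((M ^ 2 : ℝ) : ℂ) * w i) ?_ _).const_mul
      _).div_const _
    have : Tendsto (fun i => ((M : ℝ) ^ 2)⁻¹ * ((w i)⁻¹).re) l atTop :=
      hw.const_mul_atTop (by positivity)
    refine this.congr fun i => ?_
    rw [mul_inv, ← ofReal_inv, re_ofReal_mul]
  have hsum := tendsto_finsetSum (Finset.range M) (fun r _ => hlim r)
  simp only [mul_one] at hsum
  rw [residueSum, Finset.sum_div]
  refine hsum.congr' ?_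
  filter_upwards [hw.eventually_gt_atTop 0] with i hi
  have hwpos := re_pos_of_inv hi
  have hw0 : w i ≠ 0 := by
    rintro h
    simp [h] at hwpos
  rw [tsum_periodic_mul hc (summable_gaussian hwpos s), residueSum, Finset.mul_sum]
  refine Finset.sum_congr rfl fun r _ => ?_
  rw [ofReal_mul_cpow (by positivity) hw0]
  have h2 : (((M : ℝ) ^ 2 : ℝ) : ℂ) ^ (1 / 2 : ℂ) = M := by
    rw [show (1 / 2 : ℂ) = ((1 / 2 : ℝ) : ℂ) by push_cast; ring, ← ofReal_cpow (by positivity),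
      ← Real.sqrt_eq_rpow, Real.sqrt_sq hM.le]
    simp
  rw [h2]
  have h3 : ∀ m : ℤ, cexp (-Real.pi * ((M ^ 2 : ℝ) * w i) * (m + ((r + s) / M : ℝ)) ^ 2) =
      cexp (-Real.pi * w i * (((M * m + (r : ℤ) : ℤ) : ℂ) + s) ^ 2) := by
    intro m
    congr 1
    push_cast
    field_simp
    ring
  simp only [h3]
  field_simp

/-- Source of the eighth root of unity in reciprocity: the principal argument of $-i\rho$ is
$\mp\pi/2$. -/
lemma neg_I_mul_cpow {ρ : ℝ} (hρ : ρ ≠ 0) :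
    (-I * ρ) ^ (1 / 2 : ℂ) = Real.sqrt |ρ| * e (-(SignType.sign ρ : ℝ) / 8) := by
  have hhalf : ∀ r : ℝ, 0 < r → (r : ℂ) ^ (1 / 2 : ℂ) = Real.sqrt r := by
    intro r hr
    rw [show (1 / 2 : ℂ) = ((1 / 2 : ℝ) : ℂ) by push_cast; ring, ← ofReal_cpow hr.le,
      ← Real.sqrt_eq_rpow]
  rcases lt_or_gt_of_ne hρ with h | h
  · rw [show -I * (ρ : ℂ) = ((-ρ : ℝ) : ℂ) * I by push_cast; ring,
      ofReal_mul_cpow (by linarith) I_ne_zero, hhalf _ (by linarith), abs_of_neg h, sign_neg h,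
      cpow_def_of_ne_zero I_ne_zero, log_I, e, SignType.coe_neg_one]
    congr 2
    push_cast
    ring
  · rw [show -I * (ρ : ℂ) = ((ρ : ℝ) : ℂ) * (-I) by ring,
      ofReal_mul_cpow h (neg_ne_zero.mpr I_ne_zero), hhalf _ h, abs_of_pos h, sign_pos h,
      cpow_def_of_ne_zero (neg_ne_zero.mpr I_ne_zero), log_neg_I, e, SignType.coe_one]
    congr 2
    push_cast
    ring

lemma quadratic_periodic {m : ℕ} (hm : m ≠ 0) {d u : ℤ} (h : Even (d * m)) :
    Function.Periodic (fun r : ℤ => e ((d * (r : ℝ) ^ 2 - 2 * u * r) / (2 * m))) m := by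
  intro r
  obtain ⟨k, hk⟩ := h
  have hk' : (d : ℝ) * m = k + k := by exact_mod_cast hk
  have hm' : (m : ℝ) ≠ 0 := by exact_mod_cast hm
  refine e_congr (d * r + k - u) ?_
  push_cast
  field_simp
  linear_combination (m : ℝ) * hk'

lemma reciprocal_periodic {m : ℕ} (hm : m ≠ 0) {d u : ℤ} (hd : d ≠ 0) (h : Even (d * m)) :
    Function.Periodic (fun r : ℤ => e (-((m : ℝ) * r + u) ^ 2 / (2 * d * m))) d.natAbs := by
  have hper : Function.Periodic (fun r : ℤ => e (-((m : ℝ) * r + u) ^ 2 / (2 * d * m))) d := by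
    intro r
    obtain ⟨k, hk⟩ := h
    have hk' : (d : ℝ) * m = k + k := by exact_mod_cast hk
    have hm' : (m : ℝ) ≠ 0 := by exact_mod_cast hm
    have hd' : (d : ℝ) ≠ 0 := by exact_mod_cast hd
    refine e_congr (-(m * r + u + k)) ?_
    push_cast
    field_simp
    linear_combination -(d : ℝ) * m * hk'
  rcases Int.natAbs_eq d with h' | h'
  · rwa [← h']
  · rw [show ((d.natAbs : ℤ)) = -d by omega]
    exact hper.neg

/-- The Landsberg–Schaar reciprocity formula for quadratic Gauss sums with a linear term. -/
theorem landsbergSchaar {m : ℕ} (hm : m ≠ 0) {d : ℤ} (hd : d ≠ 0) (h : Even (d * m)) (u : ℤ) :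
    residueSum m (fun r => e ((d * (r : ℝ) ^ 2 - 2 * u * r) / (2 * m))) =
      (Real.sqrt m / Real.sqrt d.natAbs : ℝ) * e ((SignType.sign d : ℝ) / 8) *
        residueSum d.natAbs (fun r => e (-((m : ℝ) * r + u) ^ 2 / (2 * d * m))) := by
  have : NeZero m := ⟨hm⟩
  have : NeZero d.natAbs := ⟨by omega⟩
  have hm' : (0 : ℝ) < m := by exact_mod_cast NeZero.pos m
  have hmC : (m : ℂ) ≠ 0 := by exact_mod_cast hm
  have hd' : (d : ℝ) ≠ 0 := by exact_mod_cast hd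
  have hdC : (d : ℂ) ≠ 0 := by exact_mod_cast hd
  set c₁ : ℤ → ℂ := fun r => e ((d * (r : ℝ) ^ 2 - 2 * u * r) / (2 * m)) with hc₁
  set c₂ : ℤ → ℂ := fun r => e (-((m : ℝ) * r + u) ^ 2 / (2 * d * m)) with hc₂
  set ρ : ℝ := d / m with hρdef
  have hρ : ρ ≠ 0 := div_ne_zero hd' hm'.ne'
  have hρC : (ρ : ℂ) ≠ 0 := by exact_mod_cast hρ
  -- Here $\kappa=i\rho(\varepsilon-i\rho)$, so that
  -- $1/(\varepsilon-i\rho)=\varepsilon/\kappa+i/\rho$: a decaying part $w=\varepsilon/\kappa$ and a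
  -- purely oscillating part.
  set κ : ℝ → ℂ := fun ε => (ρ : ℂ) ^ 2 + I * ρ * ε with hκ
  have hκ0 : ∀ ε, κ ε ≠ 0 := by
    intro ε h0
    have := congrArg Complex.re h0
    simp [hκ, ← ofReal_pow] at this
    exact hρ this
  have hκre : ∀ ε, (κ ε).re = ρ ^ 2 := by
    intro ε
    simp [hκ, ← ofReal_pow]
  set w : ℝ → ℂ := fun ε => ε / κ ε with hw
  -- the two asymptotic expansions
  have hl1 : Tendsto (fun ε : ℝ => (((ε : ℂ))⁻¹).re) (𝓝[>] 0) atTop := by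
    refine tendsto_inv_nhdsGT_zero.congr fun ε => ?_
    rw [← ofReal_inv, ofReal_re]
  have hl2 : Tendsto (fun ε : ℝ => ((w ε)⁻¹).re) (𝓝[>] 0) atTop := by
    have : Tendsto (fun ε : ℝ => ρ ^ 2 * ε⁻¹) (𝓝[>] 0) atTop :=
      tendsto_inv_nhdsGT_zero.const_mul_atTop (by positivity)
    refine this.congr fun ε => ?_
    rw [hw]
    simp only
    rw [inv_div, div_eq_mul_inv, ← ofReal_inv, mul_comm (κ ε), re_ofReal_mul, hκre, mul_comm]
  have ht1 := tendsto_sqrt_mul_tsum_periodic (fun ε : ℝ => (ε : ℂ)) hl1 0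
    (quadratic_periodic hm (u := u) h)
  have ht2 := tendsto_sqrt_mul_tsum_periodic w hl2 (u / m) (reciprocal_periodic hm (u := u) hd h)
  have hcont : Tendsto (fun ε : ℝ => ((ε : ℂ) - I * ρ) ^ (1 / 2 : ℂ)) (𝓝[>] 0)
      (𝓝 ((-I * ρ) ^ (1 / 2 : ℂ))) := by
    have hc : ContinuousAt (fun z : ℂ => z ^ (1 / 2 : ℂ)) (-I * ρ) := by
      refine continuousAt_cpow_const ?_
      right
      simpa using hρ
    have hi : Tendsto (fun ε : ℝ => (ε : ℂ) - I * ρ) (𝓝[>] 0) (𝓝 (-I * ρ)) := by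
      have : Continuous (fun ε : ℝ => (ε : ℂ) - I * ρ) := by fun_prop
      have h2 := (this.tendsto 0).mono_left (nhdsWithin_le_nhds (s := Set.Ioi 0))
      simpa using h2
    exact hc.tendsto.comp hi
  have hcont2 : Tendsto (fun ε : ℝ => (κ ε) ^ (1 / 2 : ℂ)) (𝓝[>] 0) (𝓝 (|ρ| : ℝ)) := by
    have hval : ((ρ ^ 2 : ℝ) : ℂ) ^ (1 / 2 : ℂ) = (|ρ| : ℝ) := by
      rw [show (1 / 2 : ℂ) = ((1 / 2 : ℝ) : ℂ) by push_cast; ring, ← ofReal_cpow (by positivity),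
        ← Real.sqrt_eq_rpow, Real.sqrt_sq_eq_abs]
    rw [← hval]
    have hc : ContinuousAt (fun z : ℂ => z ^ (1 / 2 : ℂ)) ((ρ ^ 2 : ℝ) : ℂ) := by
      refine continuousAt_cpow_const ?_
      left
      rw [ofReal_re]
      positivity
    have hi : Tendsto κ (𝓝[>] 0) (𝓝 ((ρ ^ 2 : ℝ) : ℂ)) := by
      have : Continuous κ := by fun_prop
      have h2 := (this.tendsto 0).mono_left (nhdsWithin_le_nhds (s := Set.Ioi 0))
      simpa [hκ] using h2
    exact hc.tendsto.comp hi
  -- Poisson summation at the parameter $\varepsilon-i\rho$. On either side the oscillating part is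
  -- a periodic weight, so both limits as $\varepsilon\to0^+$ are averages of Gauss sums.
  have heq : ∀ᶠ ε : ℝ in 𝓝[>] 0,
      ((ε : ℂ) - I * ρ) ^ (1 / 2 : ℂ) * ((ε : ℂ) ^ (1 / 2 : ℂ) *
        ∑' n : ℤ, c₁ n * cexp (-Real.pi * ε * (n + (0 : ℝ)) ^ 2)) =
      (κ ε) ^ (1 / 2 : ℂ) * (w ε ^ (1 / 2 : ℂ) *
        ∑' n : ℤ, c₂ n * cexp (-Real.pi * w ε * (n + (u / m : ℝ)) ^ 2)) := by
    filter_upwards [self_mem_nhdsWithin] with ε hε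
    have hε : 0 < ε := hε
    have hεC : (ε : ℂ) ≠ 0 := by exact_mod_cast hε.ne'
    have ha : 0 < ((ε : ℂ) - I * ρ).re := by simpa using hε
    have ha0 : ((ε : ℂ) - I * ρ) ≠ 0 := by
      intro h0
      rw [h0] at ha
      simp at ha
    have hP := Complex.tsum_exp_neg_quadratic ha (-I * (u / m))
    have hL : ∀ n : ℤ, cexp (-Real.pi * ((ε : ℂ) - I * ρ) * n ^ 2 +
        2 * Real.pi * (-I * (u / m)) * n) =
        c₁ n * cexp (-Real.pi * ε * (n + (0 : ℝ)) ^ 2) := by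
      intro n
      simp only [hc₁]
      rw [e, ← exp_add]
      congr 1
      rw [hρdef]
      push_cast
      field_simp
      ring
    have hR : ∀ n : ℤ, cexp (-Real.pi / ((ε : ℂ) - I * ρ) * (n + I * (-I * (u / m))) ^ 2) =
        c₂ n * cexp (-Real.pi * w ε * (n + (u / m : ℝ)) ^ 2) := by
      intro n
      simp only [hc₂]
      rw [e, ← exp_add]
      congr 1
      have h1 : I * (-I * (u / m : ℂ)) = u / m := by linear_combination (-(u / m : ℂ)) * I_sq
      have h2 : (1 : ℂ) / ((ε : ℂ) - I * ρ) = w ε + I / ρ := by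
        simp only [hw]
        have h3 : κ ε = I * ρ * (ε - I * ρ) := by
          simp only [hκ]
          linear_combination (ρ : ℂ) ^ 2 * I_sq
        rw [h3]
        field_simp
        linear_combination -((ε : ℂ) - I * ρ) * I_sq
      rw [h1, show -(Real.pi : ℂ) / ((ε : ℂ) - I * ρ) = -Real.pi * (1 / ((ε : ℂ) - I * ρ)) by ring,
        h2, hρdef]
      push_cast
      field_simp
      ring
    simp only [hL, hR] at hP
    -- The principal branches multiply because $\kappa$ has positive real part $\rho^2$.
    have hκw : (ε : ℂ) ^ (1 / 2 : ℂ) = κ ε ^ (1 / 2 : ℂ) * w ε ^ (1 / 2 : ℂ) := by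
      rw [show w ε = ε * (κ ε)⁻¹ from div_eq_mul_inv _ _,
        ofReal_mul_cpow hε (inv_ne_zero (hκ0 ε)), inv_cpow]
      · have : κ ε ^ (1 / 2 : ℂ) ≠ 0 := by simp [cpow_eq_zero_iff, hκ0]
        field_simp
      · intro harg
        have := (arg_eq_pi_iff.mp harg).1
        rw [hκre] at this
        exact absurd this (not_lt.mpr (sq_nonneg ρ))
    have hapow : ((ε : ℂ) - I * ρ) ^ (1 / 2 : ℂ) ≠ 0 := by simp [cpow_eq_zero_iff, ha0]
    rw [hP, hκw]
    field_simp
  have hfin := tendsto_nhds_unique_of_eventuallyEq (hcont.mul ht1) (hcont2.mul ht2) heq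
  rw [neg_I_mul_cpow hρ] at hfin
  have hsgn : (SignType.sign ρ : ℝ) = (SignType.sign d : ℝ) := by
    rcases lt_or_gt_of_ne hd with h' | h'
    · rw [sign_neg h', sign_neg (div_neg_of_neg_of_pos (by exact_mod_cast h') hm')]
    · rw [sign_pos h', sign_pos (div_pos (by exact_mod_cast h') hm')]
  have habs : |ρ| = d.natAbs / m := by
    rw [hρdef, abs_div, abs_of_pos hm', Nat.cast_natAbs]
    push_cast
    rfl
  rw [hsgn, habs, Real.sqrt_div (by positivity)] at hfin
  have hdn : (0 : ℝ) < d.natAbs := by exact_mod_cast NeZero.pos d.natAbs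
  have hdnC : (d.natAbs : ℂ) ≠ 0 := by exact_mod_cast NeZero.ne d.natAbs
  have hs1 : (Real.sqrt m : ℂ) ≠ 0 := by exact_mod_cast (Real.sqrt_pos.mpr hm').ne'
  have hs2 : (Real.sqrt d.natAbs : ℂ) ≠ 0 := by exact_mod_cast (Real.sqrt_pos.mpr hdn).ne'
  have hee : e (-(SignType.sign d : ℝ) / 8) * e ((SignType.sign d : ℝ) / 8) = 1 := by
    rw [neg_div, e_neg_mul]
  generalize residueSum m c₁ = S₁ at hfin ⊢
  generalize residueSum d.natAbs c₂ = S₂ at hfin ⊢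
  generalize e (-(SignType.sign d : ℝ) / 8) = e₁ at hfin hee
  generalize e ((SignType.sign d : ℝ) / 8) = e₂ at hee ⊢
  push_cast at hfin ⊢
  rw [div_mul_div_comm, mul_comm (d.natAbs : ℂ), mul_div_mul_right _ _ hdnC] at hfin
  field_simp at hfin
  field_simp
  linear_combination e₂ * hfin - (Real.sqrt d.natAbs : ℂ) * S₁ * hee

end LandsbergSchaar

/-! ### The phase $h$ as the inverse of a normalized Gauss sum. -/

section GaussSum

open ZMod

lemma hPhase_natCast_even {a b : ℕ} (ha : 0 < a) (hb : 0 < b) (h : Even a) :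
    hPhase a b = (jacobiSym a b : ℂ) * e (((b : ℝ) - 1) / 8) := by
  have h' : Even (a : ℤ) := by exact_mod_cast h
  have hs : ((a : ℤ) * b).sign = 1 := Int.sign_eq_one_of_pos (by positivity)
  rw [hPhase, if_pos h', hs]
  simp

lemma hPhase_natCast_odd {a b : ℕ} (ha : 0 < a) (hb : 0 < b) (h : Odd a) :
    hPhase a b = (jacobiSym b a : ℂ) * e (-(a : ℝ) / 8) := by
  have h' : ¬ Even (a : ℤ) := by
    rw [Int.not_even_iff_odd]
    exact_mod_cast h
  have hs : ((a : ℤ) * b).sign = 1 := Int.sign_eq_one_of_pos (by positivity)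
  rw [hPhase, if_neg h', hs]
  simp

lemma jacobiSym_mul_self {a : ℤ} {b : ℕ} (h : IsCoprime a b) :
    (jacobiSym a b : ℂ) * jacobiSym a b = 1 := by
  have := jacobiSym.sq_one (Int.isCoprime_iff_gcd_eq_one.mp h)
  rw [← sq]
  exact_mod_cast this

lemma conj_hPhase (a b : ℤ) : (starRingEnd ℂ) (hPhase a b) = hPhase (-a) b := by
  simp only [hPhase, even_neg, abs_neg, Int.natAbs_neg, neg_mul, Int.sign_neg]
  split_ifs <;>
  · rw [map_mul, conj_e]
    simp only [map_intCast]
    congr 2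
    push_cast
    ring

lemma hPhase_neg_neg (a b : ℤ) : hPhase (-a) (-b) = hPhase a b := by
  simp only [hPhase, even_neg, abs_neg, Int.natAbs_neg, neg_mul_neg]

lemma norm_hPhase {a b : ℤ} (h : IsCoprime a b) : ‖hPhase a b‖ = 1 := by
  have key : ∀ {x : ℤ} {n : ℕ}, IsCoprime x n → ‖(jacobiSym x n : ℂ)‖ = 1 := by
    intro x n hx
    rcases jacobiSym.eq_one_or_neg_one (Int.isCoprime_iff_gcd_eq_one.mp hx) with h | h <;>
    simp [h]
  have habs : ∀ {x y : ℤ}, IsCoprime x y → IsCoprime |x| (y.natAbs : ℤ) := by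
    intro x y hx
    rw [Int.isCoprime_iff_gcd_eq_one] at hx ⊢
    simpa [Int.gcd, Int.natAbs_abs] using hx
  rw [hPhase]
  split_ifs
  · rw [norm_mul, norm_e, key (habs h), one_mul]
  · rw [norm_mul, norm_e, key (habs h.symm), one_mul]

lemma hPhase_mul_conj {a b : ℤ} (h : IsCoprime a b) :
    hPhase a b * (starRingEnd ℂ) (hPhase a b) = 1 := by
  rw [Complex.mul_conj, Complex.normSq_eq_norm_sq, norm_hPhase h]
  simp

lemma e_half_natCast (n : ℕ) : e ((n : ℝ) / 2) = (-1) ^ n := by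
  rw [show (n : ℝ) / 2 = n * (1 / 2) by ring, e_nat_mul]
  congr 1
  rw [e, show (2 * Real.pi * Complex.I * ((1 / 2 : ℝ) : ℂ) : ℂ) = Real.pi * Complex.I by
    push_cast; ring, Complex.exp_pi_mul_I]

lemma chi_eight_add_four_mul (c n : ℕ) : χ₈ ((c + 4 * n : ℕ) : ZMod 8) = (-1) ^ n * χ₈ c := by
  have h4 : ∀ x : ZMod 8, χ₈ (x + 4) = - χ₈ x := by decide
  induction n with
  | zero => simp
  | succ n ih =>
    have : ((c + 4 * (n + 1) : ℕ) : ZMod 8) = ((c + 4 * n : ℕ) : ZMod 8) + 4 := by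
      push_cast; ring
    rw [this, h4, ih, pow_succ]
    ring

lemma chi_eight_of_add {a c n : ℕ} (h : a + c = 4 * n) :
    χ₈ (c : ZMod 8) = (-1) ^ n * χ₈ (a : ZMod 8) := by
  have hneg : ∀ x : ZMod 8, χ₈ (-x) = χ₈ x := by decide
  have h1 := chi_eight_add_four_mul 0 n
  have h2 := chi_eight_add_four_mul (7 * a) n
  have h3 : ((7 * a + 4 * n : ℕ) : ZMod 8) = (c : ZMod 8) := by
    rw [← h]
    push_cast
    have : (8 : ZMod 8) = 0 := by decide
    linear_combination (a : ZMod 8) * this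
  have h4 : ((7 * a : ℕ) : ZMod 8) = -(a : ZMod 8) := by
    push_cast
    have : (8 : ZMod 8) = 0 := by decide
    linear_combination (a : ZMod 8) * this
  rw [h3, h4, hneg] at h2
  exact h2

lemma chi_four_eq_e {b : ℕ} (h : Odd b) : ((χ₄ (b : ZMod 4) : ℤ) : ℂ) = e (((b : ℝ) - 1) / 4) := by
  obtain ⟨n, rfl⟩ := h
  rw [show (((2 * n + 1 : ℕ) : ℝ) - 1) / 4 = n / 2 by push_cast; ring, e_half_natCast,
    χ₄_eq_neg_one_pow (by omega)]
  rw [show (2 * n + 1) / 2 = n by omega]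
  push_cast
  rfl

lemma jacobiSym_four_mul_left (n : ℤ) {a : ℕ} (ha : Odd a) :
    jacobiSym (4 * n) a = jacobiSym n a := by
  rw [jacobiSym.mul_left, jacobiSym.at_four ha, one_mul]

/-- The two symbols are $(c/a)$ and $(a/c)$. They agree by quadratic reciprocity, since $a+c\equiv0$
modulo $4$ makes one of $a,c$ congruent to $1$. -/
lemma jacobiSym_right_of_add {a c n : ℕ} (ha : Odd a) (hc : Odd c) (h : a + c = 4 * n) :
    jacobiSym n a = jacobiSym n c := by
  have h1 : jacobiSym n a = jacobiSym c a := by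
    rw [← jacobiSym_four_mul_left _ ha]
    apply jacobiSym.mod_left'
    rw [show (4 * n : ℤ) = c + a by exact_mod_cast h.symm.trans (add_comm _ _)]
    simp
  have h2 : jacobiSym n c = jacobiSym a c := by
    rw [← jacobiSym_four_mul_left _ hc]
    apply jacobiSym.mod_left'
    rw [show (4 * n : ℤ) = a + c by exact_mod_cast h.symm]
    simp
  rw [h1, h2]
  rcases Nat.odd_mod_four_iff.mp (Nat.odd_iff.mp ha) with h4 | h4
  · exact (jacobiSym.quadratic_reciprocity_one_mod_four h4 hc).symm
  · exact jacobiSym.quadratic_reciprocity_one_mod_four (by omega) ha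

/-- For odd $c$ and $b=2n$, the symbol $(2/\cdot)$ and the exponential each change by $(-1)^n$, and
the signs cancel. The Gauss sum has the same invariance, by `quadraticSum_add_two_mul`. -/
lemma hPhase_add_two_mul {c b : ℕ} (hc : 0 < c) (hb : 0 < b) (h : Odd (c + b)) :
    hPhase (c + 2 * b : ℕ) b = hPhase c b := by
  rcases Nat.even_or_odd c with hce | hco
  · rw [hPhase_natCast_even hc hb hce, hPhase_natCast_even (by omega) hb (by grind)]
    congr 2
    apply jacobiSym.mod_left'
    push_cast
    simp
  · obtain ⟨n, rfl⟩ : Even b := by grind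
    have hco' : Odd (c + 2 * (n + n)) := by grind
    rw [hPhase_natCast_odd hc hb hco, hPhase_natCast_odd (by omega) hb hco']
    have hJ : jacobiSym (n + n : ℕ) (c + 2 * (n + n)) = (-1) ^ n * jacobiSym (n + n : ℕ) c := by
      rw [show ((n + n : ℕ) : ℤ) = 2 * n by push_cast; ring, jacobiSym.mul_left, jacobiSym.mul_left,
        jacobiSym.at_two hco, jacobiSym.at_two hco', show 2 * (n + n) = 4 * n by ring,
        chi_eight_add_four_mul, jacobiSym.mod_right' n hco,
        jacobiSym.mod_right' n (b := c + 4 * n) (by grind), Nat.add_mod_right]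
      ring
    have he : e (-((c + 2 * (n + n) : ℕ) : ℝ) / 8) = (-1) ^ n * e (-(c : ℝ) / 8) := by
      rw [← e_half_natCast, ← e_add]
      refine e_congr (-n) ?_
      push_cast
      ring
    rw [hJ, he]
    push_cast
    have : ((-1 : ℂ) ^ n) * (-1) ^ n = 1 := by rw [← mul_pow]; simp
    linear_combination (jacobiSym ((n : ℤ) + n) c * e (-(c : ℝ) / 8)) * this

/-- Since $a\equiv-c$ modulo $2b$, this mirrors the conjugation of Gauss sums. For even $c$ the sign
$(-1/b)$ is absorbed as $e((b-1)/4)$; for odd $c$ the two signs $(-1)^n$, with $b=2n$, cancel. -/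
lemma hPhase_of_add {a c b : ℕ} (ha : 0 < a) (hc : 0 < c) (hb : 0 < b) (h : Odd (a + b))
    (hac : a + c = 2 * b) : hPhase a b = (starRingEnd ℂ) (hPhase c b) := by
  rcases Nat.even_or_odd c with hce | hco
  · have hbo : Odd b := by grind
    rw [hPhase_natCast_even hc hb hce, hPhase_natCast_even ha hb (by grind), map_mul, conj_e]
    have hJ : jacobiSym a b = χ₄ b * jacobiSym c b := by
      rw [← jacobiSym.neg _ hbo]
      apply jacobiSym.mod_left'
      rw [show (a : ℤ) = -c + b * 2 by have : (a : ℤ) + c = 2 * b := by exact_mod_cast hac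
                                       linarith]
      simp
    rw [hJ]
    push_cast
    rw [chi_four_eq_e hbo, map_intCast]
    have : e (((b : ℝ) - 1) / 4) * e (((b : ℝ) - 1) / 8) = e (-(((b : ℝ) - 1) / 8)) := by
      rw [← e_add]
      obtain ⟨n, rfl⟩ := hbo
      refine e_congr n ?_
      push_cast
      ring
    linear_combination (jacobiSym c b : ℂ) * this
  · obtain ⟨n, rfl⟩ : Even b := by grind
    have hao : Odd a := by grind
    rw [hPhase_natCast_odd hc hb hco, hPhase_natCast_odd ha hb hao, map_mul, conj_e]
    have hac' : a + c = 4 * n := by omega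
    have hJ : jacobiSym (n + n : ℕ) c = (-1) ^ n * jacobiSym (n + n : ℕ) a := by
      rw [show ((n + n : ℕ) : ℤ) = 2 * n by push_cast; ring, jacobiSym.mul_left, jacobiSym.mul_left,
        jacobiSym.at_two hco, jacobiSym.at_two hao, chi_eight_of_add hac',
        jacobiSym_right_of_add hao hco hac']
      ring
    have he : e (-(-(c : ℝ) / 8)) = (-1) ^ n * e (-(a : ℝ) / 8) := by
      rw [← e_half_natCast, ← e_add]
      refine e_congr 0 ?_
      have : (a : ℝ) + c = 4 * n := by exact_mod_cast hac'
      push_cast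
      linarith
    rw [hJ, he, map_intCast]
    push_cast
    have : ((-1 : ℂ) ^ n) * (-1) ^ n = 1 := by rw [← mul_pow]; simp
    linear_combination -(jacobiSym ((n : ℤ) + n) a * e (-(a : ℝ) / 8)) * this

/-- The quadratic Gauss sum `∑_{k mod |b|} e(a k² / (2b))`. -/
noncomputable def quadraticSum (a b : ℤ) : ℂ :=
  residueSum b.natAbs (fun k => e ((a : ℝ) * (k : ℝ) ^ 2 / (2 * b)))

lemma quadraticSum_neg_neg (a b : ℤ) : quadraticSum (-a) (-b) = quadraticSum a b := by
  rw [quadraticSum, quadraticSum, Int.natAbs_neg]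
  refine residueSum_congr fun k => ?_
  congr 1
  push_cast
  rw [mul_neg, neg_mul, neg_div_neg_eq]

lemma conj_quadraticSum (a b : ℤ) :
    (starRingEnd ℂ) (quadraticSum a b) = quadraticSum (-a) b := by
  rw [quadraticSum, quadraticSum, conj_residueSum]
  refine residueSum_congr fun k => ?_
  rw [conj_e]
  congr 1
  push_cast
  ring

lemma quadraticSum_add_two_mul (a : ℤ) {b : ℤ} (hb : b ≠ 0) :
    quadraticSum (a + 2 * b) b = quadraticSum a b := by
  refine residueSum_congr fun k => e_congr (k ^ 2) ?_
  have : (b : ℝ) ≠ 0 := by exact_mod_cast hb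
  push_cast
  field_simp
  ring

lemma quadraticSum_natCast (a b : ℕ) :
    quadraticSum a b = residueSum b (fun k => e ((a : ℝ) * (k : ℝ) ^ 2 / (2 * b))) := by
  simp [quadraticSum]

/-- Landsberg–Schaar without linear term. -/
lemma quadraticSum_swap {a b : ℕ} (ha : 0 < a) (hb : 0 < b) (h : Even (a * b)) :
    quadraticSum a b = (Real.sqrt b / Real.sqrt a : ℝ) * e (1 / 8) *
      (starRingEnd ℂ) (quadraticSum b a) := by
  have := landsbergSchaar (m := b) hb.ne' (d := a) (by omega) (by exact_mod_cast h) 0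
  simp only [Int.cast_zero, mul_zero, zero_mul, sub_zero, add_zero, Int.natAbs_natCast,
    sign_pos (show (0 : ℤ) < a by omega), Int.cast_natCast, SignType.coe_one] at this
  rw [quadraticSum_natCast, this, conj_quadraticSum, quadraticSum]
  congr 1
  simp only [Int.natAbs_natCast]
  refine residueSum_congr fun k => ?_
  congr 1
  have ha' : (a : ℝ) ≠ 0 := by exact_mod_cast ha.ne'
  have hb' : (b : ℝ) ≠ 0 := by exact_mod_cast hb.ne'
  push_cast
  field_simp

/-- One of $a,b$ is even, so both phases carry the same Jacobi symbol, whose square is $1$; no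
quadratic reciprocity is needed. -/
lemma hPhase_swap {a b : ℕ} (ha : 0 < a) (hb : 0 < b) (h : Odd (a + b)) (hab : a.Coprime b) :
    hPhase a b * e (1 / 8) * hPhase b a = 1 := by
  rcases Nat.even_or_odd a with hae | hao
  · rw [hPhase_natCast_even ha hb hae, hPhase_natCast_odd hb ha (by grind)]
    have h1 := jacobiSym_mul_self (Nat.isCoprime_iff_coprime.mpr hab)
    have h2 : e (((b : ℝ) - 1) / 8) * e (1 / 8) * e (-(b : ℝ) / 8) = 1 := by
      rw [← e_add, ← e_add]
      exact e_eq_one 0 (by push_cast; ring)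
    linear_combination (e (((b : ℝ) - 1) / 8) * e (1 / 8) * e (-(b : ℝ) / 8)) * h1 + h2
  · rw [hPhase_natCast_odd ha hb hao, hPhase_natCast_even hb ha (by grind)]
    have h1 := jacobiSym_mul_self (Nat.isCoprime_iff_coprime.mpr hab.symm)
    have h2 : e (((a : ℝ) - 1) / 8) * e (1 / 8) * e (-(a : ℝ) / 8) = 1 := by
      rw [← e_add, ← e_add]
      exact e_eq_one 0 (by push_cast; ring)
    linear_combination (e (((a : ℝ) - 1) / 8) * e (1 / 8) * e (-(a : ℝ) / 8)) * h1 + h2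

lemma quadraticSum_eq_of_swap {a b : ℕ} (ha : 0 < a) (hb : 0 < b) (h : Odd (a + b))
    (hab : a.Coprime b) (hba : hPhase b a * quadraticSum b a = Real.sqrt a) :
    hPhase a b * quadraticSum a b = Real.sqrt b := by
  have hs : (Real.sqrt a : ℂ) ≠ 0 := by
    exact_mod_cast (Real.sqrt_pos.mpr (by exact_mod_cast ha)).ne'
  rw [quadraticSum_swap ha hb (by grind)]
  have h1 := hPhase_swap ha hb h hab
  have h2 := congrArg (starRingEnd ℂ) hba
  have h3 := hPhase_mul_conj (Nat.isCoprime_iff_coprime.mpr hab.symm)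
  rw [map_mul, Complex.conj_ofReal] at h2
  generalize (starRingEnd ℂ) (quadraticSum b a) = G at *
  have h4 : G = hPhase b a * Real.sqrt a := by
    linear_combination (hPhase b a) * h2 - G * h3
  push_cast
  rw [h4]
  field_simp
  linear_combination (Real.sqrt b : ℂ) * h1

/-- Euclidean descent on $a+b$: phase and Gauss sum obey the same rules under $a\mapsto a-2b$,
$a\mapsto2b-a$ and the exchange of $a$ and $b$. -/
theorem hPhase_mul_quadraticSum_nat (s : ℕ) : ∀ a b : ℕ, a + b = s → 0 < a → 0 < b → Odd (a + b) →
    a.Coprime b → hPhase a b * quadraticSum a b = Real.sqrt b := by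
  induction s using Nat.strong_induction_on with
  | _ s ih =>
  have base : ∀ a : ℕ, 0 < a → Even a → hPhase a (1 : ℕ) * quadraticSum a (1 : ℕ) =
      Real.sqrt (1 : ℕ) := by
    intro a ha hae
    rw [hPhase_natCast_even ha one_pos hae, quadraticSum_natCast, residueSum_one]
    simp [e_zero]
  -- The range $b<a$ is settled first, because the exchange leaves $a+b$ unchanged and cannot call
  -- the induction hypothesis.
  have step : ∀ a b : ℕ, a + b = s → 0 < b → b < a → Odd (a + b) → a.Coprime b →
      hPhase a b * quadraticSum a b = Real.sqrt b := by
    intro a b hs hb hba hodd hcop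
    rcases Nat.lt_or_ge 1 b with hb1 | hb1
    · rcases lt_trichotomy a (2 * b) with hlt | heq | hgt
      · obtain ⟨c, hc⟩ : ∃ c, a + c = 2 * b := ⟨2 * b - a, by omega⟩
        have hc0 : 0 < c := by omega
        have hcb : c.Coprime b := by
          have h1 : IsCoprime (a : ℤ) b := Nat.isCoprime_iff_coprime.mpr hcop
          rw [← Nat.isCoprime_iff_coprime, show (c : ℤ) = -a + b * 2 by
            have : (a : ℤ) + c = 2 * b := by exact_mod_cast hc
            linarith]
          exact h1.neg_left.add_mul_left_left 2
        have hI := ih (c + b) (by omega) c b rfl hc0 hb (by grind) hcb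
        have hG : quadraticSum a b = (starRingEnd ℂ) (quadraticSum c b) := by
          rw [conj_quadraticSum, ← quadraticSum_add_two_mul (-(c : ℤ)) (show (b : ℤ) ≠ 0 by omega)]
          congr 1
          have : (a : ℤ) + c = 2 * b := by exact_mod_cast hc
          linarith
        rw [hPhase_of_add (by omega) hc0 hb hodd hc, hG, ← map_mul, hI, Complex.conj_ofReal]
      · exfalso
        rw [heq] at hcop
        have : b ∣ 1 := by
          rw [← hcop]
          exact Nat.dvd_gcd (Dvd.intro_left 2 rfl) dvd_rfl
        have := Nat.le_of_dvd one_pos this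
        omega
      · obtain ⟨c, rfl⟩ : ∃ c, a = c + 2 * b := ⟨a - 2 * b, by omega⟩
        have hcb : c.Coprime b := by
          simpa using hcop
        rw [hPhase_add_two_mul (by omega) hb (by grind)]
        push_cast
        rw [quadraticSum_add_two_mul _ (show (b : ℤ) ≠ 0 by omega)]
        exact ih (c + b) (by omega) c b rfl (by omega) hb (by grind) hcb
    · obtain rfl : b = 1 := by omega
      exact base a (by omega) (by grind)
  intro a b hs ha hb hodd hcop
  rcases lt_trichotomy a b with hlt | heq | hgt
  · exact quadraticSum_eq_of_swap ha hb hodd hcop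
      (step b a (by omega) ha hlt (by rwa [add_comm]) hcop.symm)
  · subst heq
    grind
  · exact step a b hs hb hgt hodd hcop

/-- The phase `h(a, b)` is the inverse of the normalized quadratic Gauss sum. -/
theorem hPhase_mul_quadraticSum {a b : ℤ} (hb : b ≠ 0) (hab : Even (a * b))
    (hcop : IsCoprime a b) : hPhase a b * quadraticSum a b = Real.sqrt b.natAbs := by
  have hpos : ∀ a b : ℤ, 0 < a → 0 < b → Even (a * b) → IsCoprime a b →
      hPhase a b * quadraticSum a b = Real.sqrt b.natAbs := by
    intro a b ha hb hab hcop
    lift a to ℕ using ha.le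
    lift b to ℕ using hb.le
    have hcop' := Nat.isCoprime_iff_coprime.mp hcop
    have hodd : Odd (a + b) := by
      rw [← Nat.not_even_iff_odd]
      intro hev
      have hab' : Even (a * b) := by exact_mod_cast hab
      have h1 : Even a := by grind
      have h2 : Even b := by grind
      have : 2 ∣ 1 := by
        rw [← hcop']
        exact Nat.dvd_gcd h1.two_dvd h2.two_dvd
      omega
    exact hPhase_mul_quadraticSum_nat _ a b rfl (by omega) (by omega) hodd hcop'
  -- Negative $a$ follows by complex conjugation; negative $b$ will follow from the symmetry
  -- $(a,b)\mapsto(-a,-b)$.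
  have hnn : ∀ a b : ℤ, 0 < b → Even (a * b) → IsCoprime a b →
      hPhase a b * quadraticSum a b = Real.sqrt b.natAbs := by
    intro a b hb hab hcop
    rcases lt_trichotomy a 0 with ha | rfl | ha
    · have := hpos (-a) b (by omega) hb (by simpa using hab) hcop.neg_left
      have h2 := congrArg (starRingEnd ℂ) this
      rwa [map_mul, conj_hPhase, conj_quadraticSum, neg_neg, Complex.conj_ofReal] at h2
    · have hb1 : b = 1 := by
        have := isCoprime_zero_left.mp hcop
        rcases Int.isUnit_iff.mp this with h | h <;> omega
      subst hb1
      simp [hPhase, quadraticSum, residueSum, e_zero]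
    · exact hpos a b ha hb hab hcop
  rcases lt_or_gt_of_ne hb with h | h
  · have := hnn (-a) (-b) (by omega) (by simpa using hab) hcop.neg_left.neg_right
    rwa [hPhase_neg_neg, quadraticSum_neg_neg, Int.natAbs_neg] at this
  · exact hnn a b h hab hcop

end GaussSum

/-! ### The propagator as a quadratic transform over lifts modulo $N|b|$. -/

section Kernel

/-- The normalized Gauss sum with parameters divided by a common factor `g`, as a full sum over
residues modulo `|b' g|`. -/
lemma normGaussSum_eq {n g : ℕ} (hn : 0 < n) (hg : 0 < g) {a b' : ℤ} (hb : b' ≠ 0)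
    (hab : Even (a * (b' * g))) (m : ℤ) :
    1 / (Real.sqrt (n : ℝ) : ℂ) * normGaussSum (n * a) b' (2 * (m : ℝ) / g) =
      1 / (Real.sqrt ((n * g : ℕ) * (b'.natAbs * g : ℕ)) : ℂ) *
        residueSum (b'.natAbs * g) (fun k =>
          e ((a * (n * g) * (k : ℝ) ^ 2 + 2 * m * k) / (2 * (b' * g)))) := by
  set β := b'.natAbs with hβ
  have hβ0 : 0 < β := by omega
  obtain ⟨σ, hσ, hbσ⟩ : ∃ σ : ℤ, σ * σ = 1 ∧ b' = σ * β := by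
    rcases Int.natAbs_eq b' with h | h
    · exact ⟨1, by ring, by omega⟩
    · exact ⟨-1, by ring, by omega⟩
  have hσ1 : σ = 1 ∨ σ = -1 := Int.isUnit_iff.mp (IsUnit.of_mul_eq_one σ hσ)
  have hβR : (β : ℝ) ≠ 0 := by exact_mod_cast hβ0.ne'
  have hgR : (g : ℝ) ≠ 0 := by exact_mod_cast hg.ne'
  have hσR : (σ : ℝ) * σ = 1 := by exact_mod_cast hσ
  have hσ0 : (σ : ℝ) ≠ 0 := by
    rintro h
    simp [h] at hσR
  have hbR : (b' : ℝ) = σ * β := by exact_mod_cast hbσ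
  obtain ⟨t, ht⟩ := hab
  have htR : (a : ℝ) * (σ * β * g) = t + t := by
    rw [← hbR]
    exact_mod_cast ht
  set f : ℤ → ℂ := fun k => e ((a * (n * g) * (k : ℝ) ^ 2 + 2 * m * k) / (2 * (b' * g))) with hf
  -- The multiplier of the summand under $k\mapsto k+|b'|$. It is a $g$-th root of unity, so the
  -- full sum is a Gauss sum modulo $|b'|$ times a geometric sum.
  set ζ : ℂ := e ((n * a * b' + σ * (2 * m / g)) / 2) with hζ
  have hshift : ∀ (i : ℤ) (j : ℕ), f (i + β * j) = f i * ζ ^ j := by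
    intro i j
    obtain ⟨q, hq⟩ := Nat.even_mul_succ_self j
    have hqR : (j : ℝ) * (j + 1) = q + q := by exact_mod_cast hq
    simp only [hf, hζ]
    rw [← e_nat_mul, ← e_add]
    refine e_congr (a * n * σ * i * j + (n * a * b' * q - n * a * b' * j)) ?_
    push_cast
    rw [hbR]
    rcases hσ1 with h | h <;> rw [h] <;> push_cast <;> field_simp
    · linear_combination (a * n * β ^ 2 * g : ℝ) * hqR
    · linear_combination (-(a * n * β ^ 2 * g) : ℝ) * hqR
  have hζg : ζ ^ g = 1 := by
    rw [hζ, ← e_nat_mul]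
    refine e_eq_one (n * t + σ * m) ?_
    push_cast
    rw [hbR]
    field_simp
    linear_combination (n : ℝ) * htR
  have hsplit : residueSum (β * g) f = residueSum β f * ∑ j ∈ Finset.range g, ζ ^ j := by
    rw [residueSum_mul, residueSum, residueSum, Finset.sum_mul]
    refine Finset.sum_congr rfl fun i _ => ?_
    rw [residueSum, Finset.mul_sum]
    exact Finset.sum_congr rfl fun j _ => hshift i j
  rw [hsplit, normGaussSum]
  split_ifs with hcond
  · obtain ⟨γ, hγ, k, hk⟩ := hcond
    have hkR : (n : ℝ) * a * b' + γ = k + k := by exact_mod_cast hk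
    have hζ1 : ζ = 1 := by
      rw [hζ, hγ]
      rcases hσ1 with h | h
      · refine e_eq_one k ?_
        rw [h]
        push_cast
        linarith
      · refine e_eq_one (n * a * b' - k) ?_
        rw [h]
        push_cast
        linarith
    have hsum : (∑ k ∈ Finset.range β, e ((((n * a : ℤ) : ℝ) * (k : ℝ) ^ 2 +
        2 * (m : ℝ) / g * (k : ℝ)) / (2 * (b' : ℝ)))) = residueSum β f := by
      refine Finset.sum_congr rfl fun k _ => ?_
      simp only [hf]
      congr 1
      have : (b' : ℝ) ≠ 0 := by exact_mod_cast hb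
      push_cast
      field_simp
    rw [hsum, hζ1]
    have hsq : Real.sqrt ((n * g : ℕ) * (β * g : ℕ)) = Real.sqrt n * Real.sqrt β * g := by
      rw [show (((n * g : ℕ) : ℝ) * ((β * g : ℕ) : ℝ)) = n * β * g ^ 2 by push_cast; ring,
        Real.sqrt_mul (by positivity), Real.sqrt_mul (by positivity), Real.sqrt_sq (by positivity)]
    have h1 : (Real.sqrt n : ℂ) ≠ 0 := by
      exact_mod_cast (Real.sqrt_pos.mpr (by exact_mod_cast hn)).ne'
    have h2 : (Real.sqrt β : ℂ) ≠ 0 := by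
      exact_mod_cast (Real.sqrt_pos.mpr (by exact_mod_cast hβ0)).ne'
    have h3 : (g : ℂ) ≠ 0 := by exact_mod_cast hg.ne'
    rw [hsq, ← hβ]
    push_cast
    simp only [one_pow, Finset.sum_const, Finset.card_range, nsmul_eq_mul, mul_one]
    field_simp
  -- The condition in `normGaussSum` says exactly that $\zeta=1$. Otherwise the geometric sum
  -- vanishes, in agreement with the default value $0$.
  · have hζ1 : ζ ≠ 1 := by
      intro h1
      obtain ⟨k, hk⟩ := (e_eq_one_iff _).mp h1
      apply hcond
      rcases hσ1 with h | h
      · rw [h] at hk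
        refine ⟨2 * k - n * a * b', ?_, k, by ring⟩
        push_cast at hk ⊢
        linarith
      · rw [h] at hk
        refine ⟨n * a * b' - 2 * k, ?_, n * a * b' - k, by ring⟩
        push_cast at hk ⊢
        linarith
    rw [geom_sum_eq hζ1, hζg]
    simp

/-- The phase `e((d Q² - 2 Q x + a x²) / (2 N b))`. -/
noncomputable def quadraticPhase (N : ℕ) (a b d : ℤ) (Q x : ℤ) : ℂ :=
  e (((d : ℝ) * (Q : ℝ) ^ 2 - 2 * Q * x + a * (x : ℝ) ^ 2) / (2 * N * b))

lemma quadraticPhase_periodic {N : ℕ} (hN : N ≠ 0) {a b : ℤ} (hb : b ≠ 0) (hab : Even (a * b))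
    (d Q : ℤ) :
    Function.Periodic (quadraticPhase N a b d Q) ((N * b.natAbs : ℕ) : ℤ) := by
  have hper : Function.Periodic (quadraticPhase N a b d Q) (N * b) := by
    intro x
    obtain ⟨k, hk⟩ := hab
    have hk' : (a : ℝ) * b = k + k := by exact_mod_cast hk
    have hN' : (N : ℝ) ≠ 0 := by exact_mod_cast hN
    have hb' : (b : ℝ) ≠ 0 := by exact_mod_cast hb
    refine e_congr (a * x - Q + N * k) ?_
    push_cast
    field_simp
    linear_combination (N : ℝ) ^ 2 * b * hk'
  rcases Int.natAbs_eq b with h | h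
  · rwa [Nat.cast_mul, ← h]
  · rw [Nat.cast_mul, show ((b.natAbs : ℤ)) = -b by omega, mul_neg]
    exact hper.neg

/-- The kernel as a sum of phases over the lifts of `Q'` to residues modulo `N b`. -/
lemma kernel_eq {N : ℕ} (hN : N ≠ 0) {a b : ℤ} (hb : b ≠ 0) (hab : Even (a * b)) (d Q Q' : ℤ) :
    kernel N a b d Q Q' = hPhase a b / (Real.sqrt (N * b.natAbs) : ℂ) *
      residueSum b.natAbs (fun k => quadraticPhase N a b d Q (Q' + N * k)) := by
  set g := Int.gcd b N with hg
  have hg0 : 0 < g := Int.gcd_pos_of_ne_zero_left _ hb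
  obtain ⟨b', hb'⟩ : (g : ℤ) ∣ b := Int.gcd_dvd_left _ _
  obtain ⟨n, hn⟩ : g ∣ N := by
    have : (g : ℤ) ∣ N := Int.gcd_dvd_right _ _
    exact_mod_cast this
  have hn0 : 0 < n := by
    rcases Nat.eq_zero_or_pos n with h | h
    · simp [h] at hn
      exact absurd hn hN
    · exact h
  have hb'0 : b' ≠ 0 := by
    rintro rfl
    simp at hb'
    exact hb hb'
  have hgZ : (g : ℤ) ≠ 0 := by exact_mod_cast hg0.ne'
  have hNg : N / g = n := by rw [hn]; exact Nat.mul_div_cancel_left _ hg0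
  have hbg : b / (g : ℤ) = b' := by rw [hb']; exact Int.mul_ediv_cancel_left _ hgZ
  have hnat : b.natAbs = b'.natAbs * g := by
    rw [hb', Int.natAbs_mul, Int.natAbs_natCast, mul_comm]
  rw [kernel, ← hg, hNg, hbg, div_eq_mul_one_div (hPhase a b), mul_assoc (hPhase a b)]
  have hmain := normGaussSum_eq hn0 hg0 hb'0 (a := a)
    (by rwa [mul_comm b', ← hb']) (a * Q' - Q)
  push_cast at hmain
  have hsq : ((n : ℝ) * g * (b'.natAbs * g)) = (N * b.natAbs : ℝ) := by
    rw [hnat, hn]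
    push_cast
    ring
  rw [hsq] at hmain
  have hsum : residueSum (b'.natAbs * g) (fun k => e ((a * (n * g) * (k : ℝ) ^ 2 +
      2 * (a * Q' - Q) * k) / (2 * (b' * g)))) *
      e (((d : ℝ) * (Q : ℝ) ^ 2 - 2 * Q * Q' + a * (Q' : ℝ) ^ 2) / (2 * N * b)) =
      residueSum b.natAbs (fun k => quadraticPhase N a b d Q (Q' + N * k)) := by
    rw [← residueSum_mul_const, hnat]
    refine residueSum_congr fun k => ?_
    rw [quadraticPhase, ← e_add]
    congr 1
    have h1 : (N : ℝ) = g * n := by exact_mod_cast hn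
    have h2 : (b : ℝ) = g * b' := by exact_mod_cast hb'
    have h3 : (g : ℝ) ≠ 0 := by exact_mod_cast hg0.ne'
    have h4 : (n : ℝ) ≠ 0 := by exact_mod_cast hn0.ne'
    have h5 : (b' : ℝ) ≠ 0 := by exact_mod_cast hb'0
    push_cast
    rw [h1, h2]
    field_simp
    ring
  rw [hmain, ← hsum]
  ring

/-- The unnormalized propagator for `b ≠ 0`, as a function on the integers. -/
noncomputable def quadraticTransform (N : ℕ) (a b d : ℤ) (Φ : ZMod N → ℂ) (Q : ℤ) : ℂ :=
  residueSum (N * b.natAbs) (fun x => quadraticPhase N a b d Q x * Φ (x : ZMod N))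

/-- Cases (ii) and (iii) become one formula: if $a=0$ then $b=\pm1$, the phase is $1$ and the lifts
reduce to residues modulo $N$. -/
lemma propagatorFun_eq {N : ℕ} [NeZero N] {a b c d : ℤ} (hb : b ≠ 0) (hab : Even (a * b))
    (hdet : a * d - b * c = 1) (Φ : ZMod N → ℂ) (Q : ZMod N) :
    propagatorFun N a b c d Φ Q = hPhase a b / (Real.sqrt (N * b.natAbs) : ℂ) *
      quadraticTransform N a b d Φ (Q.val : ℤ) := by
  have hN : N ≠ 0 := NeZero.ne N
  have hkernel : ∑ Q' : ZMod N, (hPhase a b / (Real.sqrt (N * b.natAbs) : ℂ) *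
      residueSum b.natAbs (fun k => quadraticPhase N a b d Q.val ((Q'.val : ℤ) + N * k))) * Φ Q' =
      hPhase a b / (Real.sqrt (N * b.natAbs) : ℂ) *
        quadraticTransform N a b d Φ (Q.val : ℤ) := by
    rw [quadraticTransform, residueSum_mul, ← sum_zmod_val, Finset.mul_sum]
    refine Finset.sum_congr rfl fun Q' _ => ?_
    rw [mul_assoc, ← residueSum_mul_const]
    congr 1
    refine residueSum_congr fun k => ?_
    congr 2
    simp
  rw [propagatorFun, if_neg hb]
  split_ifs with ha
  · rw [← hkernel, Finset.mul_sum]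
    refine Finset.sum_congr rfl fun Q' _ => ?_
    subst ha
    have hbu : b = 1 ∨ b = -1 := by
      have : IsUnit b := IsUnit.of_mul_eq_one (-c) (by linarith)
      exact Int.isUnit_iff.mp this
    have hNR : (N : ℝ) ≠ 0 := by exact_mod_cast hN
    rcases hbu with rfl | rfl
    · simp only [Int.natAbs_one, residueSum_one, hPhase, quadraticPhase]
      rw [mul_assoc]
      simp [e_zero]
      rw [← mul_assoc]
      congr 3
      field_simp
    · simp only [Int.natAbs_neg, Int.natAbs_one, residueSum_one, hPhase, quadraticPhase]
      rw [mul_assoc]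
      simp [e_zero]
      rw [← mul_assoc]
      congr 3
      field_simp
  · rw [← hkernel]
    refine Finset.sum_congr rfl fun Q' _ => ?_
    rw [kernel_eq hN hb hab]

/-- The behaviour of the phase under the phase space translation by `(t, v)`. -/
lemma quadraticPhase_translate {N : ℕ} (hN : N ≠ 0) {a b c d : ℤ} (hb : b ≠ 0)
    (hdet : a * d - b * c = 1) (Q x t v : ℤ) :
    quadraticPhase N a b d (Q + (a * t + b * v)) (x + t) = quadraticPhase N a b d Q x *
      e ((2 * ((Q : ℝ) * (c * t + d * v) - x * v) +
        ((a * t + b * v) * (c * t + d * v) - t * v)) / (2 * N)) := by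
  have hN' : (N : ℝ) ≠ 0 := by exact_mod_cast hN
  have hb' : (b : ℝ) ≠ 0 := by exact_mod_cast hb
  have hdet' : (a : ℝ) * d - b * c = 1 := by exact_mod_cast hdet
  rw [quadraticPhase, quadraticPhase, ← e_add]
  congr 1
  push_cast
  field_simp
  linear_combination (a * (t : ℝ) ^ 2 + 2 * Q * t + b * t * v) * hdet'

lemma quadraticTransform_periodic {N : ℕ} (hN : N ≠ 0) {a b c d : ℤ} (hb : b ≠ 0)
    (hab : Even (a * b)) (hcd : Even (c * d)) (hdet : a * d - b * c = 1) (Φ : ZMod N → ℂ) :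
    Function.Periodic (quadraticTransform N a b d Φ) N := by
  intro Q
  have hper : Function.Periodic (fun x : ℤ => quadraticPhase N a b d (Q + N) x * Φ (x : ZMod N))
      ((N * b.natAbs : ℕ) : ℤ) := by
    intro x
    simp only
    rw [quadraticPhase_periodic hN hb hab]
    simp
  rw [quadraticTransform, ← residueSum_add hper (d * N), quadraticTransform]
  refine residueSum_congr fun x => ?_
  -- The vector $(dN,-cN)$ is the preimage of $(N,0)$ under the matrix; the remaining phase is
  -- trivial because $cd$ is even.
  have h := quadraticPhase_translate hN hb hdet Q x (d * N) (-c * N)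
  rw [show a * (d * N) + b * (-c * N) = (N : ℤ) by linear_combination (N : ℤ) * hdet] at h
  rw [h]
  obtain ⟨k, hk⟩ := hcd
  have hk' : (c : ℝ) * d = k + k := by exact_mod_cast hk
  have hN' : (N : ℝ) ≠ 0 := by exact_mod_cast hN
  rw [e_eq_one (x * c + N * k), mul_one]
  · congr 2
    simp
  · push_cast
    field_simp
    linear_combination (N : ℝ) * hk'

end Kernel

/-! ### Multiplicativity for the generators. -/

section Composition

lemma propagatorFun_intCast {N : ℕ} [NeZero N] {a b c d : ℤ} (hb : b ≠ 0) (hab : Even (a * b))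
    (hcd : Even (c * d)) (hdet : a * d - b * c = 1) (Φ : ZMod N → ℂ) (q : ℤ) :
    propagatorFun N a b c d Φ q = hPhase a b / (Real.sqrt (N * b.natAbs) : ℂ) *
      quadraticTransform N a b d Φ q := by
  rw [propagatorFun_eq hb hab hdet,
    periodic_val (quadraticTransform_periodic (NeZero.ne N) hb hab hcd hdet Φ)]

lemma propagatorFun_zero_intCast {N : ℕ} [NeZero N] {a c : ℤ} (d : ℤ) (hc : Even c)
    (Φ : ZMod N → ℂ) (q : ℤ) :
    propagatorFun N a 0 c d Φ q =
      e ((a : ℝ) * c * (q : ℝ) ^ 2 / (2 * N)) * Φ ((a * q : ℤ) : ZMod N) := by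
  have hper : Function.Periodic (fun q : ℤ => e ((a : ℝ) * c * (q : ℝ) ^ 2 / (2 * N))) N := by
    intro q
    obtain ⟨k, rfl⟩ := hc
    have hN' : (N : ℝ) ≠ 0 := by exact_mod_cast NeZero.ne N
    refine e_congr (a * k * (2 * q + N)) ?_
    push_cast
    field_simp
    ring
  have := periodic_val hper q
  simp only [Int.cast_natCast] at this
  rw [propagatorFun, if_pos rfl, this]
  push_cast
  rfl

lemma propagatorFun_fourier_intCast {N : ℕ} [NeZero N] (Φ : ZMod N → ℂ) (q : ℤ) :
    propagatorFun N 0 (-1) 1 0 Φ q =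
      1 / (Real.sqrt N : ℂ) * residueSum N (fun R => e ((q : ℝ) * R / N) * Φ R) := by
  have hN' : (N : ℝ) ≠ 0 := by exact_mod_cast NeZero.ne N
  rw [propagatorFun, if_neg (by norm_num), if_pos rfl, ← sum_zmod_val]
  congr 1
  refine Finset.sum_congr rfl fun R _ => ?_
  have hper : Function.Periodic (fun q : ℤ => e ((q : ℝ) * (R.val : ℤ) / N)) N := by
    intro q
    refine e_congr R.val ?_
    push_cast
    field_simp
    ring
  rw [← periodic_val hper q]
  congr 1
  · refine e_congr 0 ?_
    push_cast
    field_simp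
    ring
  · simp

lemma quadraticPhase_lift_periodic {N : ℕ} (hN : N ≠ 0) {a b : ℤ} (hb : b ≠ 0)
    (hab : Even (a * b)) (d q x : ℤ) :
    Function.Periodic (fun j : ℤ => quadraticPhase N a b d q (x + N * j)) b.natAbs := by
  intro j
  refine periodic_of_dvd (quadraticPhase_periodic hN hb hab d q) ⟨1, ?_⟩
  rw [Nat.cast_mul]
  ring

/-- As a function of $R$ the summand is a Gauss summand with leading coefficient $d$ and modulus
$Nb$; its reciprocal sum, modulo $|d|$, is the kernel of $\begin{pmatrix}-c&-d\\a&b\end{pmatrix}$.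
-/
lemma quadraticPhase_fourier {N : ℕ} (hN : N ≠ 0) {a b c d : ℤ} (hb : b ≠ 0) (hd : d ≠ 0)
    (hab : Even (a * b)) (hcd : Even (c * d)) (hbd : Even (b * d)) (hdet : a * d - b * c = 1)
    (q x : ℤ) :
    residueSum (N * b.natAbs) (fun R => e ((q : ℝ) * R / N) * quadraticPhase N a b d R x) =
      (Real.sqrt (N * b.natAbs) / Real.sqrt d.natAbs : ℝ) *
        e ((SignType.sign (b.sign * d) : ℝ) / 8) *
        residueSum d.natAbs (fun j => quadraticPhase N (-c) (-d) b q (x + N * j)) := by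
  have hN' : (N : ℝ) ≠ 0 := by exact_mod_cast hN
  have hb' : (b : ℝ) ≠ 0 := by exact_mod_cast hb
  have hd' : (d : ℝ) ≠ 0 := by exact_mod_cast hd
  have hdet' : (a : ℝ) * d - b * c = 1 := by exact_mod_cast hdet
  set σ := b.sign with hσ
  have hσb : (b.natAbs : ℤ) = σ * b := by rw [hσ, Int.sign_mul_self_eq_natAbs]
  have hσσ : σ * σ = 1 := by
    rcases lt_or_gt_of_ne hb with h | h
    · rw [hσ, Int.sign_eq_neg_one_of_neg h]; rfl
    · rw [hσ, Int.sign_eq_one_of_pos h]; rfl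
  have hσbR : (b.natAbs : ℝ) = σ * b := by
    rw [← Int.cast_natCast, hσb, Int.cast_mul]
  have hσσR : (σ : ℝ) * σ = 1 := by exact_mod_cast hσσ
  have hσ0 : (σ : ℝ) ≠ 0 := by
    intro h
    simp [h] at hσσR
  have hσ0' : σ ≠ 0 := by exact_mod_cast hσ0
  have hm : N * b.natAbs ≠ 0 := mul_ne_zero hN (by omega)
  have hev : Even (σ * d * (N * b.natAbs : ℕ)) := by
    rw [Nat.cast_mul, hσb, show σ * d * (N * (σ * b)) = (σ * σ) * N * (b * d) by ring]
    exact hbd.mul_left _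
  -- The sign $\sigma$ of $b$ is moved to the numerator, since reciprocity needs the positive
  -- modulus $N|b|$.
  have hLS := landsbergSchaar hm (mul_ne_zero hσ0' hd) hev (σ * (x - q * b))
  have hnat : (σ * d).natAbs = d.natAbs := by
    rw [Int.natAbs_mul, show σ.natAbs = 1 by
      rcases Int.isUnit_iff.mp (IsUnit.of_mul_eq_one σ hσσ) with h | h <;> simp [h], one_mul]
  have hL : ∀ R : ℤ, e ((q : ℝ) * R / N) * quadraticPhase N a b d R x =
      e ((a : ℝ) * x ^ 2 / (2 * N * b)) * e ((((σ * d : ℤ) : ℝ) * (R : ℝ) ^ 2 -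
        2 * ((σ * (x - q * b) : ℤ) : ℝ) * R) / (2 * ((N * b.natAbs : ℕ) : ℝ))) := by
    intro R
    rw [quadraticPhase, ← e_add, ← e_add]
    congr 1
    push_cast
    rw [hσbR]
    field_simp
    ring
  have hcop : IsCoprime b d.natAbs := by
    have : IsCoprime b d := ⟨-c, a, by linarith⟩
    rcases Int.natAbs_eq d with h | h
    · rwa [← h]
    · rw [show ((d.natAbs : ℤ)) = -d by omega]
      exact this.neg_right
  have hdet2 : -c * b - -d * a = 1 := by linarith
  have hper : Function.Periodic (fun j : ℤ => quadraticPhase N (-c) (-d) b q (x + N * j))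
      d.natAbs := by
    have := quadraticPhase_lift_periodic hN (neg_ne_zero.mpr hd) (a := -c) (by simpa using hcd) b q x
    rwa [Int.natAbs_neg] at this
  have hR : ∀ j : ℤ, e ((a : ℝ) * x ^ 2 / (2 * N * b)) *
      e (-(((N * b.natAbs : ℕ) : ℝ) * j + ((σ * (x - q * b) : ℤ) : ℝ)) ^ 2 /
        (2 * ((σ * d : ℤ) : ℝ) * ((N * b.natAbs : ℕ) : ℝ))) =
      quadraticPhase N (-c) (-d) b q (x + N * (b * j + 0)) := by
    intro j
    have h1 : quadraticPhase N (-c) (-d) b (q - N * j) x =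
        quadraticPhase N (-c) (-d) b q (x + N * (b * j + 0)) := by
      -- Reciprocity yields the phase at $(q-Nj,x)$. Translation by $(bNj,-aNj)$ restores $q$ and
      -- shifts $x$ by $bNj$; the extra phase is trivial because $ab$ is even.
      have h := quadraticPhase_translate hN (neg_ne_zero.mpr hd) hdet2 (q - N * j) x
        (b * N * j) (-a * N * j)
      rw [show q - N * j + (-c * (b * N * j) + -d * (-a * N * j)) = q by
        linear_combination (N * j : ℤ) * hdet] at h
      rw [show x + N * (b * j + 0) = x + b * N * j by ring, h]
      obtain ⟨k, hk⟩ := hab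
      have hk' : (a : ℝ) * b = k + k := by exact_mod_cast hk
      rw [e_eq_one (x * a * j + N * k * j ^ 2), mul_one]
      push_cast
      field_simp
      linear_combination (N * (j : ℝ) ^ 2 : ℝ) * hk'
    rw [← h1, quadraticPhase, ← e_add]
    congr 1
    push_cast
    rw [hσbR]
    rcases Int.isUnit_iff.mp (IsUnit.of_mul_eq_one σ hσσ) with h | h
    · rw [h]
      push_cast
      field_simp
      linear_combination (x ^ 2 : ℝ) * hdet'
    · rw [h]
      push_cast
      field_simp
      linear_combination (x ^ 2 : ℝ) * hdet'
  -- The last rewrite replaces $bj$ by $j$, as $b$ is invertible modulo $d$.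
  rw [residueSum_congr hL, residueSum_const_mul, hLS, ← mul_assoc, mul_comm (e _), mul_assoc,
    ← residueSum_const_mul, residueSum_congr (fun j => hR j), hnat, residueSum_affine hper hcop 0]
  push_cast
  rfl

/-- The discrete Fourier transform of the unnormalized propagator. -/
lemma residueSum_mul_quadraticTransform {N : ℕ} [NeZero N] {a b c d : ℤ} (hb : b ≠ 0) (hd : d ≠ 0)
    (hab : Even (a * b)) (hcd : Even (c * d)) (hbd : Even (b * d)) (hdet : a * d - b * c = 1)
    (Φ : ZMod N → ℂ) (q : ℤ) :
    residueSum N (fun R => e ((q : ℝ) * R / N) * quadraticTransform N a b d Φ R) =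
      (Real.sqrt (N * b.natAbs) / Real.sqrt d.natAbs : ℝ) *
        e ((SignType.sign (b.sign * d) : ℝ) / 8) * quadraticTransform N (-c) (-d) b Φ q := by
  have hN := NeZero.ne N
  have hN' : (N : ℝ) ≠ 0 := by exact_mod_cast hN
  have hper : Function.Periodic (fun R : ℤ => e ((q : ℝ) * R / N) *
      quadraticTransform N a b d Φ R) N := by
    intro R
    simp only
    rw [quadraticTransform_periodic hN hb hab hcd hdet]
    congr 1
    refine e_congr q ?_
    push_cast
    field_simp
    ring
  have hbn : (b.natAbs : ℂ) ≠ 0 := by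
    have : b.natAbs ≠ 0 := by omega
    exact_mod_cast this
  have hneg : Even (-c * -d) := by simpa using hcd
  set H : ℤ → ℂ := fun x => residueSum d.natAbs
    (fun j => quadraticPhase N (-c) (-d) b q (x + N * j)) with hH
  have hHper : Function.Periodic (fun x : ℤ => H x * Φ (x : ZMod N)) N := by
    intro x
    have hp := quadraticPhase_lift_periodic hN (neg_ne_zero.mpr hd) hneg b q x
    rw [Int.natAbs_neg] at hp
    have : H (x + N) = H x := by
      simp only [hH]
      rw [← residueSum_add hp 1]
      refine residueSum_congr fun j => ?_
      congr 1
      ring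
    simp only [this]
    simp
  have hT : quadraticTransform N (-c) (-d) b Φ q =
      residueSum N (fun x => H x * Φ (x : ZMod N)) := by
    rw [quadraticTransform, residueSum_mul, Int.natAbs_neg]
    refine residueSum_congr fun x => ?_
    simp only [hH]
    rw [← residueSum_mul_const]
    refine residueSum_congr fun j => ?_
    simp
  -- Multiplying by $|b|$ extends the sum over $R$ to $N|b|$ residues, as reciprocity needs; the
  -- factor reappears when the sum over $x$ collapses to $N$ residues.
  apply mul_left_cancel₀ hbn
  rw [hT, ← residueSum_extend _ _ hper]
  simp only [quadraticTransform, ← residueSum_const_mul]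
  rw [residueSum_comm]
  have hstep : ∀ x : ℤ, residueSum (N * b.natAbs) (fun R => e ((q : ℝ) * R / N) *
      (quadraticPhase N a b d R x * Φ (x : ZMod N))) =
      ((Real.sqrt (N * b.natAbs) / Real.sqrt d.natAbs : ℝ) *
        e ((SignType.sign (b.sign * d) : ℝ) / 8)) * (H x * Φ (x : ZMod N)) := by
    intro x
    simp only [← mul_assoc]
    rw [residueSum_mul_const, quadraticPhase_fourier hN hb hd hab hcd hbd hdet]
  rw [residueSum_congr hstep, residueSum_const_mul, residueSum_extend _ _ hHper]
  simp only [residueSum_const_mul]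
  ring

lemma isCoprime_of_mul_eq_one {u v : ℤ} (h : u * v = 1) (n : ℤ) : IsCoprime u n :=
  ⟨v, 0, by linarith⟩

lemma residueSum_e_mul {N : ℕ} (hN : N ≠ 0) {y : ℕ} (hy : y < N) :
    residueSum N (fun R => e ((y : ℝ) * R / N)) = if y = 0 then (N : ℂ) else 0 := by
  have hNR : (N : ℝ) ≠ 0 := by exact_mod_cast hN
  have hpow : ∀ R : ℕ, e ((y : ℝ) * ((R : ℤ) : ℝ) / N) = e ((y : ℝ) / N) ^ R := by
    intro R
    rw [← e_nat_mul]
    congr 1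
    push_cast
    ring
  rw [residueSum]
  simp only [hpow]
  split_ifs with h
  · simp [h, e_zero]
  · have hne : e ((y : ℝ) / N) ≠ 1 := by
      intro h1
      obtain ⟨n, hn⟩ := (e_eq_one_iff _).mp h1
      rw [div_eq_iff hNR] at hn
      have hn' : (y : ℤ) = n * N := by exact_mod_cast hn
      have : (N : ℤ) ∣ y := ⟨n, by linarith⟩
      exact h (Nat.eq_zero_of_dvd_of_lt (by exact_mod_cast this) hy)
    have h1 : e ((y : ℝ) / N) ^ N = 1 := by
      rw [← e_nat_mul]
      refine e_eq_one y ?_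
      push_cast
      field_simp
    rw [geom_sum_eq hne, h1]
    simp

lemma hPhase_of_sq_eq_one {a b : ℤ} (ha : Even a) (hb : b * b = 1) : hPhase a b = 1 := by
  rw [hPhase, if_pos ha]
  rcases Int.isUnit_iff.mp (IsUnit.of_mul_eq_one b hb) with rfl | rfl <;> simp [e_zero]

lemma quadraticTransform_one (a b d : ℤ) :
    quadraticTransform 1 a b d (fun _ => 1) 0 = quadraticSum a b := by
  simp [quadraticTransform, quadraticPhase, quadraticSum]

lemma isCoprime_of_det {a b c d : ℤ} (hdet : a * d - b * c = 1) : IsCoprime a b :=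
  ⟨d, -c, by linarith⟩

/-- The transformation of the phase under multiplication by the Fourier matrix. -/
lemma hPhase_fourier {a b c d : ℤ} (hb : b ≠ 0) (hd : d ≠ 0) (hab : Even (a * b))
    (hcd : Even (c * d)) (hbd : Even (b * d)) (hdet : a * d - b * c = 1) :
    hPhase (-c) (-d) = e ((SignType.sign (b.sign * d) : ℝ) / 8) * hPhase a b := by
  -- At level $1$ both transforms are plain Gauss sums, so the relation between their phases can be
  -- read off.
  have h := residueSum_mul_quadraticTransform (N := 1) hb hd hab hcd hbd hdet (fun _ => 1) 0
  rw [residueSum_one, quadraticTransform_one, quadraticTransform_one] at h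
  have h1 := hPhase_mul_quadraticSum hb hab (isCoprime_of_det hdet)
  have h2 := hPhase_mul_quadraticSum (neg_ne_zero.mpr hd) (a := -c) (by simpa using hcd)
    (isCoprime_of_det (show -c * b - -d * a = 1 by linarith))
  rw [Int.natAbs_neg] at h2
  have hs1 : (Real.sqrt b.natAbs : ℂ) ≠ 0 := by
    have : 0 < b.natAbs := by omega
    exact_mod_cast (Real.sqrt_pos.mpr (by exact_mod_cast this)).ne'
  have hs2 : (Real.sqrt d.natAbs : ℂ) ≠ 0 := by
    have : 0 < d.natAbs := by omega
    exact_mod_cast (Real.sqrt_pos.mpr (by exact_mod_cast this)).ne'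
  simp only [Int.cast_zero, mul_zero, zero_div, e_zero, one_mul, Nat.cast_one] at h
  push_cast at h
  rw [div_mul_eq_mul_div, div_mul_eq_mul_div, eq_div_iff hs2] at h
  generalize e ((SignType.sign (b.sign * d) : ℝ) / 8) = ε at *
  generalize quadraticSum a b = G at *
  generalize quadraticSum (-c) (-d) = G' at *
  generalize hPhase a b = x at *
  generalize hPhase (-c) (-d) = y at *
  apply mul_left_cancel₀ (mul_ne_zero hs1 hs2)
  linear_combination (-(y * Real.sqrt d.natAbs)) * h1 + (ε * Real.sqrt b.natAbs * x) * h2 +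
    x * y * h

/-- Left multiplication by the Fourier matrix `(0 -1; 1 0)`. -/
theorem propagatorFun_fourier_comp {N : ℕ} [NeZero N] {a b c d : ℤ} (hab : Even (a * b))
    (hcd : Even (c * d)) (hdet : a * d - b * c = 1) (Φ : ZMod N → ℂ) :
    propagatorFun N 0 (-1) 1 0 (propagatorFun N a b c d Φ) =
      propagatorFun N (-c) (-d) a b Φ := by
  have hN := NeZero.ne N
  have hNR : (N : ℝ) ≠ 0 := by exact_mod_cast hN
  have hNpos : (0 : ℝ) < N := by positivity
  have hsN : (Real.sqrt N : ℂ) ≠ 0 := by exact_mod_cast (Real.sqrt_pos.mpr hNpos).ne'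
  funext Q
  obtain ⟨q, rfl⟩ := ZMod.intCast_surjective Q
  rw [propagatorFun_fourier_intCast]
  have hcd' : Even (-c * -d) := by simpa using hcd
  rcases eq_or_ne b 0 with rfl | hb
  · have had : a * d = 1 := by linarith
    have hda : d = a ∧ a * a = 1 := by
      rcases Int.isUnit_iff.mp (IsUnit.of_mul_eq_one d had) with rfl | rfl <;> constructor <;> omega
    obtain ⟨rfl, haa⟩ := hda
    have hd0 : d ≠ 0 := by
      rintro rfl
      simp at haa
    have hce : Even c := by
      rcases Int.isUnit_iff.mp (IsUnit.of_mul_eq_one d had) with rfl | rfl <;> simpa using hcd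
    have hn1 : d.natAbs = 1 := by
      rcases Int.isUnit_iff.mp (IsUnit.of_mul_eq_one d had) with rfl | rfl <;> rfl
    rw [propagatorFun_intCast (neg_ne_zero.mpr hd0) hcd' hab (by linarith),
      hPhase_of_sq_eq_one hce.neg (by linarith), Int.natAbs_neg, hn1, Nat.cast_one, mul_one,
      quadraticTransform, Int.natAbs_neg, hn1, mul_one]
    congr 1
    have hper : Function.Periodic
        (fun x : ℤ => quadraticPhase N (-c) (-d) 0 q x * Φ (x : ZMod N)) N := by
      intro x
      have := quadraticPhase_periodic hN (neg_ne_zero.mpr hd0) hcd' 0 q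
      rw [Int.natAbs_neg, hn1, mul_one] at this
      simp only [this x]
      simp
    rw [← residueSum_affine hper (isCoprime_of_mul_eq_one had _) 0]
    refine residueSum_congr fun R => ?_
    rw [propagatorFun_zero_intCast _ hce, ← mul_assoc, ← e_add, quadraticPhase, add_zero]
    congr 2
    rcases Int.isUnit_iff.mp (IsUnit.of_mul_eq_one d had) with rfl | rfl
    · push_cast
      field_simp
      ring
    · push_cast
      field_simp
      ring
  rcases eq_or_ne d 0 with rfl | hd
  · have hbc : b * -c = 1 := by linarith
    have hcb : b = -c ∧ b * b = 1 := by
      rcases Int.isUnit_iff.mp (IsUnit.of_mul_eq_one _ hbc) with rfl | rfl <;> constructor <;> omega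
    obtain ⟨hbc', hbb⟩ := hcb
    have hae : Even a := by
      rcases Int.isUnit_iff.mp (IsUnit.of_mul_eq_one _ hbc) with rfl | rfl <;> simpa using hab
    have hn1 : b.natAbs = 1 := by
      rcases Int.isUnit_iff.mp (IsUnit.of_mul_eq_one _ hbc) with rfl | rfl <;> rfl
    rw [← hbc', neg_zero, propagatorFun_zero_intCast _ hae]
    -- For $d=0$ reciprocity does not apply; the inner sum over $R$ is instead evaluated by
    -- orthogonality of characters.
    set f : ℤ → ℂ := fun x => e ((a : ℝ) * x ^ 2 / (2 * N * b)) * Φ (x : ZMod N) *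
      residueSum N (fun R => e (((q - x * b : ℤ) : ℝ) * R / N)) with hf
    have hfper : Function.Periodic f N := by
      intro x
      have h1 : e ((a : ℝ) * ((x + N : ℤ) : ℝ) ^ 2 / (2 * N * b)) =
          e ((a : ℝ) * x ^ 2 / (2 * N * b)) := by
        obtain ⟨k, rfl⟩ := hae
        refine e_congr (b * k * (2 * x + N)) ?_
        rcases Int.isUnit_iff.mp (IsUnit.of_mul_eq_one _ hbc) with h | h
        · rw [h]
          push_cast
          field_simp
          ring
        · rw [h]
          push_cast
          field_simp
          ring
      have h2 : residueSum N (fun R => e (((q - (x + N) * b : ℤ) : ℝ) * R / N)) =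
          residueSum N (fun R => e (((q - x * b : ℤ) : ℝ) * R / N)) := by
        refine residueSum_congr fun R => e_congr (-b * R) ?_
        push_cast
        field_simp
        ring
      simp only [hf, h1, h2]
      simp
    have hb0 : b ≠ 0 := by
      rintro rfl
      simp at hbb
    have hbb' : (b : ℝ) * b = 1 := by exact_mod_cast hbb
    have hbR : (b : ℝ) ≠ 0 := by exact_mod_cast hb0
    have hsum : residueSum N (fun R => e ((q : ℝ) * R / N) * propagatorFun N a b c 0 Φ R) =
        1 / (Real.sqrt N : ℂ) * residueSum N f := by
      have h1 : ∀ R : ℤ, e ((q : ℝ) * R / N) * propagatorFun N a b c 0 Φ R =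
          1 / (Real.sqrt N : ℂ) * residueSum N (fun x => e ((q : ℝ) * R / N) *
            (quadraticPhase N a b 0 R x * Φ (x : ZMod N))) := by
        intro R
        rw [propagatorFun_intCast hb0 hab hcd hdet, hPhase_of_sq_eq_one hae hbb, hn1, Nat.cast_one,
          mul_one, quadraticTransform, hn1, mul_one, residueSum_const_mul]
        ring
      rw [residueSum_congr h1, residueSum_const_mul, residueSum_comm]
      congr 1
      refine residueSum_congr fun x => ?_
      simp only [hf]
      rw [← residueSum_const_mul]
      refine residueSum_congr fun R => ?_
      rw [mul_right_comm _ (Φ _), ← e_add, ← mul_assoc, quadraticPhase, ← e_add]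
      congr 2
      push_cast
      field_simp
      linear_combination (2 * x * R : ℝ) * hbb'
    -- Substituting $x=-by+bq$ makes $q-xb=y$, as $b^2=1$, so only $y=0$ contributes.
    rw [hsum, ← residueSum_affine hfper (isCoprime_of_mul_eq_one (show -b * -b = 1 by linarith) _)
      (b * q), residueSum, Finset.sum_eq_single 0]
    · simp only [hf]
      rw [residueSum_congr (g := fun _ => 1)]
      · have h1 : (N : ℂ) = Real.sqrt N * Real.sqrt N := by
          rw [← Complex.ofReal_mul, Real.mul_self_sqrt hNpos.le]
          simp
        have h2 : e ((a : ℝ) * ((-b * ((0 : ℕ) : ℤ) + b * q : ℤ) : ℝ) ^ 2 / (2 * N * b)) =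
            e ((b : ℝ) * a * (q : ℝ) ^ 2 / (2 * N)) := by
          congr 1
          push_cast
          field_simp
          ring
        rw [h2]
        simp [residueSum]
        rw [h1]
        field_simp
      · intro R
        refine e_eq_one 0 ?_
        push_cast
        have : (q : ℝ) - (-b * 0 + b * q) * b = 0 := by linear_combination -(q : ℝ) * hbb'
        rw [this]
        simp
    · intro y hy hy0
      simp only [hf]
      rw [show q - (-b * (y : ℤ) + b * q) * b = (y : ℤ) by
        linear_combination ((y : ℤ) - q) * hbb]
      have := residueSum_e_mul hN (Finset.mem_range.mp hy)
      rw [if_neg hy0] at this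
      simp only [Int.cast_natCast]
      rw [this, mul_zero]
    · intro h
      exact absurd (Finset.mem_range.mpr (Nat.pos_of_ne_zero hN)) h
  -- Modulo $2$ an element of the theta group is the identity or the swap.
  have hbd : Even (b * d) := by
    have : ¬ Even (1 : ℤ) := by decide
    rw [← hdet, Int.even_sub, Int.even_mul, Int.even_mul] at this
    rw [Int.even_mul] at hab hcd ⊢
    tauto
  rw [propagatorFun_intCast (neg_ne_zero.mpr hd) hcd' hab (by linarith)]
  have : ∀ R : ℤ, e ((q : ℝ) * R / N) * propagatorFun N a b c d Φ R =
      hPhase a b / (Real.sqrt (N * b.natAbs) : ℂ) *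
        (e ((q : ℝ) * R / N) * quadraticTransform N a b d Φ R) := by
    intro R
    rw [propagatorFun_intCast hb hab hcd hdet]
    ring
  rw [residueSum_congr this, residueSum_const_mul,
    residueSum_mul_quadraticTransform hb hd hab hcd hbd hdet, hPhase_fourier hb hd hab hcd hbd hdet,
    Int.natAbs_neg, Real.sqrt_mul hNpos.le, Real.sqrt_mul hNpos.le]
  have hs1 : (Real.sqrt b.natAbs : ℂ) ≠ 0 := by
    have : 0 < b.natAbs := by omega
    exact_mod_cast (Real.sqrt_pos.mpr (by exact_mod_cast this)).ne'
  have hs2 : (Real.sqrt d.natAbs : ℂ) ≠ 0 := by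
    have : 0 < d.natAbs := by omega
    exact_mod_cast (Real.sqrt_pos.mpr (by exact_mod_cast this)).ne'
  push_cast
  field_simp

/-- Left multiplication by a matrix with `b = 0`. -/
theorem propagatorFun_lower_comp {N : ℕ} [NeZero N] {α γ : ℤ} (hα : α * α = 1) (hγ : Even γ)
    {a b c d : ℤ} (hab : Even (a * b)) (hcd : Even (c * d)) (hdet : a * d - b * c = 1)
    (Φ : ZMod N → ℂ) :
    propagatorFun N α 0 γ α (propagatorFun N a b c d Φ) =
      propagatorFun N (α * a) (α * b) (γ * a + α * c) (γ * b + α * d) Φ := by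
  have hNR : (N : ℝ) ≠ 0 := by exact_mod_cast NeZero.ne N
  funext Q
  obtain ⟨q, rfl⟩ := ZMod.intCast_surjective Q
  rw [propagatorFun_zero_intCast _ hγ]
  have hα1 := Int.isUnit_iff.mp (IsUnit.of_mul_eq_one α hα)
  rcases eq_or_ne b 0 with rfl | hb
  · have had : a * d = 1 := by linarith
    have hce : Even c := by
      have := Int.isUnit_iff.mp (IsUnit.of_mul_eq_one a (by linarith : d * a = 1))
      rcases this with rfl | rfl <;> simpa using hcd
    have haa : (a : ℝ) * a = 1 := by
      rcases Int.isUnit_iff.mp (IsUnit.of_mul_eq_one d had) with rfl | rfl <;> norm_num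
    rw [mul_zero, propagatorFun_zero_intCast _ hce,
      propagatorFun_zero_intCast _ ((hγ.mul_right a).add (hce.mul_left α)), ← mul_assoc, ← e_add]
    congr 2
    · push_cast
      field_simp
      linear_combination -(α * γ : ℝ) * haa * q ^ 2
    · congr 1
      ring
  · have hb' : α * b ≠ 0 := by
      rcases hα1 with rfl | rfl <;> simpa using hb
    have hbR : (b : ℝ) ≠ 0 := by exact_mod_cast hb
    have hab' : Even (α * a * (α * b)) := by
      rw [show α * a * (α * b) = α * α * (a * b) by ring, hα, one_mul]
      exact hab
    have hh : hPhase (α * a) (α * b) = hPhase a b := by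
      rcases hα1 with rfl | rfl
      · simp
      · simpa using hPhase_neg_neg a b
    have hnat : (α * b).natAbs = b.natAbs := by
      rcases hα1 with rfl | rfl <;> simp
    have hcd' : Even ((γ * a + α * c) * (γ * b + α * d)) := by
      rw [Int.even_mul] at hcd ⊢
      rcases hcd with h | h
      · exact Or.inl ((hγ.mul_right a).add (h.mul_left α))
      · exact Or.inr ((hγ.mul_right b).add (h.mul_left α))
    rw [propagatorFun_intCast hb hab hcd hdet, propagatorFun_intCast hb' hab' hcd'
      (by linear_combination α * α * hdet + hα), hh, hnat, mul_left_comm]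
    congr 1
    rw [quadraticTransform, quadraticTransform, hnat, ← residueSum_const_mul]
    refine residueSum_congr fun x => ?_
    rw [← mul_assoc, quadraticPhase, quadraticPhase, ← e_add]
    congr 2
    rcases hα1 with rfl | rfl
    · push_cast
      field_simp
      ring
    · push_cast
      field_simp
      ring

end Composition

/-! ### Generators of the theta group. -/

section ThetaGroup

lemma even_row_zero (A : thetaGroup ℤ) : Even (A.1 0 0 * A.1 0 1) :=
  even_iff_two_dvd.mpr A.2.1

lemma even_row_one (A : thetaGroup ℤ) : Even (A.1 1 0 * A.1 1 1) :=
  even_iff_two_dvd.mpr A.2.2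

lemma det_eq_one (A : thetaGroup ℤ) : A.1 0 0 * A.1 1 1 - A.1 0 1 * A.1 1 0 = 1 := by
  rw [← Matrix.det_fin_two, A.1.det_coe]

/-- The Fourier matrix `(0 -1; 1 0)`. -/
def fourierElement : thetaGroup ℤ :=
  ⟨⟨!![0, -1; 1, 0], by simp [Matrix.det_fin_two]⟩, by
    constructor <;> simp⟩

/-- The lower triangular matrix `(α 0; γ α)` with `α = ±1` and `γ` even. -/
def lowerElement (α γ : ℤ) (hα : α * α = 1) (hγ : Even γ) : thetaGroup ℤ :=
  ⟨⟨!![α, 0; γ, α], by simp [Matrix.det_fin_two, hα]⟩, by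
    constructor
    · simp
    · simpa using hγ.two_dvd.mul_right α⟩

lemma mul_entry (A B : thetaGroup ℤ) (i j : Fin 2) :
    (A * B).1 i j = A.1 i 0 * B.1 0 j + A.1 i 1 * B.1 1 j := by
  change (A.1 * B.1) i j = _
  rw [Matrix.SpecialLinearGroup.coe_mul, Matrix.mul_apply, Fin.sum_univ_two]

lemma inv_entry (A : thetaGroup ℤ) :
    A⁻¹.1 0 0 = A.1 1 1 ∧ A⁻¹.1 0 1 = -A.1 0 1 ∧ A⁻¹.1 1 0 = -A.1 1 0 ∧ A⁻¹.1 1 1 = A.1 0 0 := by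
  have : A⁻¹.1 = A.1⁻¹ := rfl
  rw [this, Matrix.SpecialLinearGroup.SL2_inv_expl]
  exact ⟨rfl, rfl, rfl, rfl⟩

lemma fourierElement_entry : fourierElement.1 0 0 = 0 ∧ fourierElement.1 0 1 = -1 ∧
    fourierElement.1 1 0 = 1 ∧ fourierElement.1 1 1 = 0 := ⟨rfl, rfl, rfl, rfl⟩

lemma lowerElement_entry (α γ : ℤ) (hα : α * α = 1) (hγ : Even γ) :
    (lowerElement α γ hα hγ).1 0 0 = α ∧ (lowerElement α γ hα hγ).1 0 1 = 0 ∧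
      (lowerElement α γ hα hγ).1 1 0 = γ ∧ (lowerElement α γ hα hγ).1 1 1 = α :=
  ⟨rfl, rfl, rfl, rfl⟩

/-- Balanced division of $d$ by $2b$. Only the remainder $|b|$ would fail to shrink, and it is
excluded because $b$ and $d$ have opposite parity. -/
lemma exists_even_abs_lt {b d : ℤ} (hb : b ≠ 0) (h : ¬ (2 : ℤ) ∣ b - d) :
    ∃ n : ℤ, Even n ∧ (d + n * b).natAbs < b.natAbs := by
  have h2b : 2 * b ≠ 0 := by omega
  have h0 := Int.emod_nonneg d h2b
  have h1 := Int.emod_lt_abs d h2b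
  have h2 := Int.emod_add_mul_ediv d (2 * b)
  set r := d % (2 * b)
  set k := d / (2 * b)
  have habs : |2 * b| = 2 * |b| := by rw [abs_mul]; rfl
  rw [habs] at h1
  have hnat : (b.natAbs : ℤ) = |b| := Int.natCast_natAbs b
  rcases lt_trichotomy r |b| with hr | hr | hr
  · refine ⟨-2 * k, ⟨-k, by ring⟩, ?_⟩
    have : d + -2 * k * b = r := by linarith
    omega
  · exfalso
    apply h
    rcases abs_choice b with hc | hc
    · exact ⟨-(b * k), by rw [← h2, hr, hc]; ring⟩
    · exact ⟨b - b * k, by rw [← h2, hr, hc]; ring⟩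
  · rcases abs_choice b with hc | hc
    · refine ⟨-2 * k - 2, ⟨-k - 1, by ring⟩, ?_⟩
      have : d + (-2 * k - 2) * b = r - 2 * b := by linarith
      rw [this]
      omega
    · refine ⟨-2 * k + 2, ⟨-k + 1, by ring⟩, ?_⟩
      have : d + (-2 * k + 2) * b = r + 2 * b := by linarith
      rw [this]
      omega

/-- The theta group is generated by the Fourier matrix and the lower triangular matrices. -/
theorem thetaGroup_induction {P : thetaGroup ℤ → Prop} (hF : P fourierElement)
    (hL : ∀ α γ hα hγ, P (lowerElement α γ hα hγ)) (hmul : ∀ A B, P A → P B → P (A * B))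
    (A : thetaGroup ℤ) : P A := by
  induction hn : (A.1 0 1).natAbs using Nat.strong_induction_on generalizing A with
  | _ n ih =>
  have hdet := det_eq_one A
  have hab := even_row_zero A
  have hcd := even_row_one A
  rcases eq_or_ne (A.1 0 1) 0 with hb | hb
  · rw [hb] at hdet
    have had : A.1 0 0 * A.1 1 1 = 1 := by linarith
    have hda : A.1 1 1 = A.1 0 0 := by
      rcases Int.mul_eq_one_iff_eq_one_or_neg_one.mp had with h | h <;> rw [h.1, h.2]
    have hγ : Even (A.1 1 0) := by
      rcases Int.mul_eq_one_iff_eq_one_or_neg_one.mp had with h | h <;> rw [h.2] at hcd <;>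
      simpa using hcd
    have : A = lowerElement (A.1 0 0) (A.1 1 0) (by rw [hda] at had; exact had) hγ := by
      apply Subtype.ext
      apply Subtype.ext
      ext i j
      fin_cases i <;> fin_cases j
      · rfl
      · exact hb
      · rfl
      · exact hda
    rw [this]
    exact hL _ _ _ _
  · have hpar : ¬ (2 : ℤ) ∣ A.1 0 1 - A.1 1 1 := by
      rw [← even_iff_two_dvd, Int.even_sub]
      have h1 : ¬ Even (1 : ℤ) := by decide
      rw [← hdet, Int.even_sub, Int.even_mul, Int.even_mul] at h1
      rw [Int.even_mul] at hab hcd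
      tauto
    obtain ⟨k, hk, hlt⟩ := exists_even_abs_lt hb hpar
    set L := lowerElement 1 (-k) (by norm_num) hk.neg
    -- One Euclidean step: the last factor has upper right entry $d+kb$, smaller than $b$ in
    -- absolute value.
    have hA : A = L * (fourierElement * (fourierElement⁻¹ * (L⁻¹ * A))) := by group
    rw [hA]
    refine hmul _ _ (hL _ _ _ _) (hmul _ _ hF (ih _ ?_ _ rfl))
    rw [← hn]
    have : (fourierElement⁻¹ * (L⁻¹ * A)).1 0 1 = A.1 1 1 + k * A.1 0 1 := by
      obtain ⟨h00, h01, h10, h11⟩ := inv_entry fourierElement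
      obtain ⟨k00, k01, k10, k11⟩ := inv_entry L
      obtain ⟨f00, f01, f10, f11⟩ := fourierElement_entry
      obtain ⟨l00, l01, l10, l11⟩ := lowerElement_entry 1 (-k) (by norm_num) hk.neg
      simp only [mul_entry, h00, h01, k00, k01, k10, k11, f01, f11, L, l00, l01, l10, l11]
      ring
    rw [this]
    exact hlt

end ThetaGroup

/-! ### The unitary representation of the theta group. -/

section Representation

variable {N : ℕ} [NeZero N]

lemma propagator_apply (A : thetaGroup ℤ) (Φ : Hilb N) (Q : ZMod N) :
    propagator N A Φ Q =
      propagatorFun N (A.1 0 0) (A.1 0 1) (A.1 1 0) (A.1 1 1) (fun Q => Φ Q) Q := rfl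

lemma propagator_fourier_mul (A : thetaGroup ℤ) :
    propagator N (fourierElement * A) = propagator N fourierElement ∘ₗ propagator N A := by
  refine LinearMap.ext fun Φ => ?_
  ext Q
  have h := congrFun (propagatorFun_fourier_comp (N := N) (even_row_zero A) (even_row_one A)
    (det_eq_one A) (fun Q => Φ Q)) Q
  rw [LinearMap.comp_apply, propagator_apply, propagator_apply]
  simp only [propagator_apply]
  rw [show (fourierElement * A).1 0 0 = -A.1 1 0 by
      simp only [mul_entry, fourierElement_entry]; ring,
    show (fourierElement * A).1 0 1 = -A.1 1 1 by
      simp only [mul_entry, fourierElement_entry]; ring,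
    show (fourierElement * A).1 1 0 = A.1 0 0 by
      simp only [mul_entry, fourierElement_entry]; ring,
    show (fourierElement * A).1 1 1 = A.1 0 1 by
      simp only [mul_entry, fourierElement_entry]; ring]
  exact h.symm

lemma propagator_lower_mul {α γ : ℤ} (hα : α * α = 1) (hγ : Even γ) (A : thetaGroup ℤ) :
    propagator N (lowerElement α γ hα hγ * A) =
      propagator N (lowerElement α γ hα hγ) ∘ₗ propagator N A := by
  refine LinearMap.ext fun Φ => ?_
  ext Q
  have h := congrFun (propagatorFun_lower_comp (N := N) hα hγ (even_row_zero A) (even_row_one A)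
    (det_eq_one A) (fun Q => Φ Q)) Q
  rw [LinearMap.comp_apply, propagator_apply, propagator_apply]
  simp only [propagator_apply]
  rw [show (lowerElement α γ hα hγ * A).1 0 0 = α * A.1 0 0 by
      simp only [mul_entry, lowerElement_entry]; ring,
    show (lowerElement α γ hα hγ * A).1 0 1 = α * A.1 0 1 by
      simp only [mul_entry, lowerElement_entry]; ring,
    show (lowerElement α γ hα hγ * A).1 1 0 = γ * A.1 0 0 + α * A.1 1 0 by
      simp only [mul_entry, lowerElement_entry],
    show (lowerElement α γ hα hγ * A).1 1 1 = γ * A.1 0 1 + α * A.1 1 1 by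
      simp only [mul_entry, lowerElement_entry]]
  exact h.symm

theorem propagator_mul (A B : thetaGroup ℤ) :
    propagator N (A * B) = propagator N A ∘ₗ propagator N B := by
  refine thetaGroup_induction (P := fun A => ∀ B, propagator N (A * B) =
    propagator N A ∘ₗ propagator N B) propagator_fourier_mul
    (fun α γ hα hγ => propagator_lower_mul hα hγ) (fun A A' hA hA' B => ?_) A B
  rw [mul_assoc, hA, hA', hA, LinearMap.comp_assoc]

theorem propagator_one : propagator N 1 = LinearMap.id := by
  refine LinearMap.ext fun Φ => ?_
  ext Q
  rw [propagator_apply, propagatorFun]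
  simp [e_zero]

lemma norm_sq_eq_residueSum (Φ : Hilb N) :
    ((‖Φ‖ ^ 2 : ℝ) : ℂ) = residueSum N (fun q => Φ (q : ZMod N) *
      (starRingEnd ℂ) (Φ (q : ZMod N))) := by
  rw [EuclideanSpace.norm_sq_eq, ← sum_zmod_eq N (fun q => Φ q * (starRingEnd ℂ) (Φ q))]
  push_cast
  refine Finset.sum_congr rfl fun q _ => ?_
  rw [Complex.mul_conj, Complex.normSq_eq_norm_sq]
  push_cast
  rfl

/-- Plancherel. Multiplicativity shows that the square of the transform is the parity operator,
which inverts it once $\overline\Psi$ is expanded and the sums are exchanged. -/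
lemma norm_propagator_fourier (Φ : Hilb N) : ‖propagator N fourierElement Φ‖ = ‖Φ‖ := by
  set Ψ := propagator N fourierElement Φ with hΨ
  have happ : ∀ (X : Hilb N) (q : ℤ), propagator N fourierElement X (q : ZMod N) =
      1 / (Real.sqrt N : ℂ) * residueSum N (fun R => e ((q : ℝ) * R / N) * X (R : ZMod N)) :=
    fun X q => propagatorFun_fourier_intCast _ q
  have hpar : ∀ R : ℤ, propagator N fourierElement Ψ ((-R : ℤ) : ZMod N) = Φ (R : ZMod N) := by
    intro R
    have h := propagator_fourier_mul (N := N) fourierElement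
    rw [hΨ, ← LinearMap.comp_apply, ← h, propagator_apply]
    simp only [propagatorFun, mul_entry, fourierElement_entry]
    simp [e_zero]
  have hconj : ∀ q : ℤ, (starRingEnd ℂ) (Ψ (q : ZMod N)) = 1 / (Real.sqrt N : ℂ) *
      residueSum N (fun R => e (((-R : ℤ) : ℝ) * q / N) *
        (starRingEnd ℂ) (Φ (R : ZMod N))) := by
    intro q
    rw [hΨ, happ, map_mul, conj_residueSum]
    congr 1
    · simp
    · refine residueSum_congr fun R => ?_
      rw [map_mul, conj_e]
      congr 2
      push_cast
      ring
  have hsq : ((‖Ψ‖ ^ 2 : ℝ) : ℂ) = ((‖Φ‖ ^ 2 : ℝ) : ℂ) := by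
    rw [norm_sq_eq_residueSum, norm_sq_eq_residueSum]
    simp only [hconj, ← residueSum_const_mul]
    rw [residueSum_comm]
    refine residueSum_congr fun R => ?_
    have h := hpar R
    rw [happ] at h
    rw [← h, ← residueSum_const_mul, ← residueSum_mul_const]
    refine residueSum_congr fun q => ?_
    ring
  have h2 : ‖Ψ‖ ^ 2 = ‖Φ‖ ^ 2 := by exact_mod_cast hsq
  exact (sq_eq_sq₀ (norm_nonneg _) (norm_nonneg _)).mp h2

lemma norm_propagator_lower {α γ : ℤ} (hα : α * α = 1) (hγ : Even γ) (Φ : Hilb N) :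
    ‖propagator N (lowerElement α γ hα hγ) Φ‖ = ‖Φ‖ := by
  have hinv : Function.Involutive (fun Q : ZMod N => (α : ZMod N) * Q) := by
    intro Q
    have : (α : ZMod N) * α = 1 := by exact_mod_cast congrArg (Int.cast : ℤ → ZMod N) hα
    simp only
    rw [← mul_assoc, this, one_mul]
  have h2 : ‖propagator N (lowerElement α γ hα hγ) Φ‖ ^ 2 = ‖Φ‖ ^ 2 := by
    rw [EuclideanSpace.norm_sq_eq, EuclideanSpace.norm_sq_eq,
      ← hinv.bijective.sum_comp (fun Q => ‖Φ Q‖ ^ 2)]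
    refine Finset.sum_congr rfl fun Q _ => ?_
    rw [propagator_apply, propagatorFun]
    simp [lowerElement_entry, norm_e]
  exact (sq_eq_sq₀ (norm_nonneg _) (norm_nonneg _)).mp h2

theorem norm_propagator (A : thetaGroup ℤ) (Φ : Hilb N) : ‖propagator N A Φ‖ = ‖Φ‖ := by
  refine thetaGroup_induction (P := fun A => ∀ Φ : Hilb N, ‖propagator N A Φ‖ = ‖Φ‖)
    norm_propagator_fourier (fun α γ hα hγ => norm_propagator_lower hα hγ)
    (fun A B hA hB Φ => ?_) A Φ
  rw [propagator_mul, LinearMap.comp_apply, hA, hB]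

/-- The propagators as a unitary representation of the theta group. -/
noncomputable def propagatorHom (N : ℕ) [NeZero N] : thetaGroup ℤ →* (Hilb N ≃ₗᵢ[ℂ] Hilb N) where
  toFun A :=
    { toLinearEquiv := LinearEquiv.ofLinearMap (propagator N A) (propagator N A⁻¹)
        (by rw [← propagator_mul, mul_inv_cancel, propagator_one])
        (by rw [← propagator_mul, inv_mul_cancel, propagator_one])
      norm_map' := norm_propagator A }
  map_one' := by
    ext Φ : 1
    change propagator N 1 Φ = Φ
    rw [propagator_one, LinearMap.id_apply]
  map_mul' A B := by
    ext Φ : 1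
    change propagator N (A * B) Φ = propagator N A (propagator N B Φ)
    rw [propagator_mul, LinearMap.comp_apply]

lemma propagatorHom_apply (A : thetaGroup ℤ) (Φ : Hilb N) :
    propagatorHom N A Φ = propagator N A Φ := rfl

end Representation

/-! ### Surjectivity of reduction modulo $4N$. -/

section Reduction

/-- Units modulo $\gcd(c,n)$ lift to units modulo $c$; Bézout then changes $d$ to the lift modulo
$c$ by a multiple of $n$. -/
lemma exists_isCoprime_modEq {c n : ℤ} (hc : c ≠ 0) (d : ℤ) (h : IsCoprime d (Int.gcd c n : ℤ)) :
    ∃ t : ℤ, IsCoprime (d + n * t) c := by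
  have : NeZero c.natAbs := ⟨by omega⟩
  have hdvd : Int.gcd c n ∣ c.natAbs := Int.natCast_dvd_natCast.mp (by
    rw [Int.dvd_natAbs]
    exact Int.gcd_dvd_left _ _)
  obtain ⟨u, hu⟩ := ZMod.unitsMap_surjective hdvd (ZMod.unitOfIsCoprime d h)
  obtain ⟨x, hx⟩ := ZMod.intCast_surjective (u : ZMod c.natAbs)
  have hxd : ((x : ℤ) : ZMod (Int.gcd c n)) = d := by
    have h1 := congrArg Units.val hu
    rw [ZMod.unitsMap_def, Units.coe_map, ← hx, ZMod.coe_unitOfIsCoprime] at h1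
    simpa using h1
  have hxc : IsCoprime x c := by
    have h1 : IsCoprime x (c.natAbs : ℤ) := by
      refine IsCoprime.symm ((ZMod.coe_int_isUnit_iff_isCoprime _ _).mp ?_)
      rw [hx]
      exact u.isUnit
    rcases Int.natAbs_eq c with h2 | h2
    · rwa [← h2] at h1
    · rw [h2]
      exact h1.neg_right
  obtain ⟨s, hs⟩ : (Int.gcd c n : ℤ) ∣ x - d := by
    rw [← ZMod.intCast_zmod_eq_zero_iff_dvd]
    push_cast
    rw [hxd, sub_self]
  refine ⟨Int.gcdB c n * s, ?_⟩
  have : d + n * (Int.gcdB c n * s) = x + c * (-(Int.gcdA c n * s)) := by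
    have := Int.gcd_eq_gcd_ab c n
    linear_combination -hs - s * this
  rw [this]
  exact hxc.add_mul_left_left _

/-- Reduction modulo `n` is surjective on the special linear groups of degree two. -/
theorem exists_SL2_lift {n : ℕ} [NeZero n] (A : SL(2, ZMod n)) :
    ∃ B : SL(2, ℤ), ∀ i j, ((B i j : ℤ) : ZMod n) = A i j := by
  have hn : (n : ℤ) ≠ 0 := by exact_mod_cast NeZero.ne n
  obtain ⟨a, ha⟩ := ZMod.intCast_surjective (A 0 0)
  obtain ⟨b, hb⟩ := ZMod.intCast_surjective (A 0 1)
  obtain ⟨c, hc0, hc⟩ : ∃ c : ℤ, c ≠ 0 ∧ (c : ZMod n) = A 1 0 := by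
    obtain ⟨c, hc⟩ := ZMod.intCast_surjective (A 1 0)
    rcases eq_or_ne c 0 with rfl | h
    · exact ⟨n, hn, by simpa using hc⟩
    · exact ⟨c, h, hc⟩
  obtain ⟨d, hd⟩ := ZMod.intCast_surjective (A 1 1)
  have hdet : A 0 0 * A 1 1 - A 0 1 * A 1 0 = 1 := by
    rw [← Matrix.det_fin_two, A.det_coe]
  obtain ⟨k, hk⟩ : (n : ℤ) ∣ a * d - b * c - 1 := by
    rw [← ZMod.intCast_zmod_eq_zero_iff_dvd]
    push_cast
    rw [ha, hb, hc, hd, hdet, sub_self]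
  have hcop : IsCoprime d (Int.gcd c n : ℤ) := by
    obtain ⟨r, hr⟩ : (Int.gcd c n : ℤ) ∣ c := Int.gcd_dvd_left _ _
    obtain ⟨s, hs⟩ : (Int.gcd c n : ℤ) ∣ n := Int.gcd_dvd_right _ _
    refine ⟨a, -b * r - s * k, ?_⟩
    linear_combination hk + b * hr + k * hs
  obtain ⟨t, u, v, ht⟩ := exists_isCoprime_modEq hc0 d hcop
  -- With $d$ replaced by $d+nt$ the determinant is $1+nk'$. The Bézout relation $u(d+nt)+vc=1$
  -- allows $a$ and $b$ to be corrected by multiples of $n$.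
  set k' := k + a * t with hk'
  have hk2 : a * (d + n * t) - b * c - 1 = n * k' := by
    rw [hk']
    linear_combination hk
  refine ⟨⟨!![a - n * k' * u, b + n * k' * v; c, d + n * t], ?_⟩, ?_⟩
  · rw [Matrix.det_fin_two_of]
    linear_combination hk2 - n * k' * ht
  · intro i j
    fin_cases i <;> fin_cases j
    · simpa using ha
    · simpa using hb
    · simpa using hc
    · simpa using hd

/-- Any lift to $SL(2,\mathbb Z)$ is already in the theta group, because $4N$ is even and parity is
visible modulo $4N$. -/
theorem thetaReduction_surjective (N : ℕ) [NeZero N] :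
    Function.Surjective (thetaReduction N) := by
  rintro ⟨A, h0, h1⟩
  have : NeZero (4 * N) := ⟨by have := NeZero.ne N; omega⟩
  obtain ⟨B, hB⟩ := exists_SL2_lift A
  have hdvd : ∀ x : ℤ, (2 : ZMod (4 * N)) ∣ (x : ZMod (4 * N)) → (2 : ℤ) ∣ x := by
    rintro x ⟨y, hy⟩
    obtain ⟨z, rfl⟩ := ZMod.intCast_surjective y
    have h2 : ((4 * N : ℕ) : ℤ) ∣ x - 2 * z := by
      rw [← ZMod.intCast_zmod_eq_zero_iff_dvd]
      push_cast
      rw [hy, sub_self]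
    obtain ⟨w, hw⟩ := h2
    refine ⟨z + 2 * N * w, ?_⟩
    push_cast at hw
    linarith
  refine ⟨⟨B, hdvd _ ?_, hdvd _ ?_⟩, ?_⟩
  · push_cast
    rw [hB, hB]
    exact h0
  · push_cast
    rw [hB, hB]
    exact h1
  · apply Subtype.ext
    apply Subtype.ext
    ext i j
    exact hB i j

lemma thetaReduction_entry (N : ℕ) (A : thetaGroup ℤ) (i j : Fin 2) :
    (thetaReduction N A).1 i j = ((A.1 i j : ℤ) : ZMod (4 * N)) := rfl

lemma thetaReduction_eq_iff (N : ℕ) (A B : thetaGroup ℤ) :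
    thetaReduction N A = thetaReduction N B ↔
      ∀ i j : Fin 2, A.1 i j ≡ B.1 i j [ZMOD (4 * N : ℤ)] := by
  have key : ∀ i j, (thetaReduction N A).1 i j = (thetaReduction N B).1 i j ↔
      A.1 i j ≡ B.1 i j [ZMOD (4 * N : ℤ)] := by
    intro i j
    rw [thetaReduction_entry, thetaReduction_entry, ZMod.intCast_eq_intCast_iff]
    push_cast
    rfl
  constructor
  · intro h i j
    rw [← key, h]
  · intro h
    apply Subtype.ext
    apply Subtype.ext
    ext i j
    exact (key i j).mpr (h i j)

end Reduction

/-! ### Matrices congruent to the identity. -/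

section Identity

variable {N : ℕ} [NeZero N]

/-- The symbol $(N/\cdot)$ has period $4N$ on odd arguments, so $|a|$ may be replaced by $1$ or, for
negative $a$, by $4N-1$; there $(N/(4N-1))=(4N/(4N-1))=1$. -/
lemma jacobiSym_of_modEq_one {a : ℤ} (h : a ≡ 1 [ZMOD (4 * N : ℤ)]) :
    jacobiSym N a.natAbs = 1 := by
  have hN : 0 < N := NeZero.pos N
  obtain ⟨k, hk⟩ := h.symm.dvd
  have hred : ∀ {m r : ℕ}, Odd m → m % (4 * N) = r % (4 * N) → Odd r →
      jacobiSym N m = jacobiSym N r := by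
    intro m r hm hmr hr
    rw [jacobiSym.mod_right' N hm, hmr, ← jacobiSym.mod_right' N hr]
  have hodd : Odd a.natAbs := by
    rw [Int.natAbs_odd]
    exact ⟨2 * N * k, by linarith⟩
  rcases le_or_gt 0 a with ha | ha
  · have h1 : a.natAbs % (4 * N) = 1 % (4 * N) := by
      change a.natAbs ≡ 1 [MOD 4 * N]
      rw [← Int.natCast_modEq_iff, Int.natAbs_of_nonneg ha]
      exact_mod_cast h
    rw [hred hodd h1 odd_one, jacobiSym.one_right]
  · have h1 : a.natAbs % (4 * N) = (4 * N - 1) % (4 * N) := by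
      change a.natAbs ≡ 4 * N - 1 [MOD 4 * N]
      rw [← Int.natCast_modEq_iff, Int.ofNat_natAbs_of_nonpos ha.le, Nat.cast_sub (by omega)]
      refine (Int.modEq_iff_dvd.mpr ⟨1 + k, ?_⟩)
      push_cast
      linarith
    have hodd' : Odd (4 * N - 1) := ⟨2 * N - 1, by omega⟩
    rw [hred hodd h1 hodd', ← jacobiSym_four_mul_left _ hodd', ← jacobiSym.one_left (4 * N - 1)]
    apply jacobiSym.mod_left'
    rw [Nat.cast_sub (by omega)]
    push_cast
    exact Int.modEq_iff_dvd.mpr ⟨-1, by ring⟩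

lemma quadraticPhase_one (a b k : ℤ) :
    quadraticPhase 1 a b 0 0 k = e ((a : ℝ) * (k : ℝ) ^ 2 / (2 * b)) := by
  rw [quadraticPhase]
  congr 1
  push_cast
  ring

lemma hPhase_mul_level {a b : ℤ} (ha : ¬ Even a) :
    hPhase a (N * b) = jacobiSym N a.natAbs * hPhase a b := by
  have hN : (0 : ℤ) < N := by exact_mod_cast NeZero.pos N
  have hs : (a * (N * b)).sign = (a * b).sign := by
    rw [show a * (N * b) = N * (a * b) by ring, Int.sign_mul, Int.sign_eq_one_of_pos hN, one_mul]
  rw [hPhase, if_neg ha, hPhase, if_neg ha, hs, abs_mul, abs_of_pos hN, jacobiSym.mul_left]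
  push_cast
  ring

/-- Only $x=Nk$ contributes, with phase $e(ak^2/(2b))$; as $k$ runs modulo $N|b|$, the Gauss sum
modulo $|b|$ is repeated $N$ times. -/
lemma quadraticTransform_single_zero {a b : ℤ} (hb : b ≠ 0) (hab : Even (a * b)) (d : ℤ) :
    quadraticTransform N a (N * b) d (Pi.single 0 1) 0 = N * quadraticSum a b := by
  have hN : N ≠ 0 := NeZero.ne N
  have hNR : (N : ℝ) ≠ 0 := by exact_mod_cast hN
  rw [quadraticTransform, residueSum_mul, residueSum, Finset.sum_eq_single 0]
  · have h1 : ∀ k : ℤ, quadraticPhase N a (N * b) d 0 (((0 : ℕ) : ℤ) + N * k) *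
        (Pi.single 0 1 : ZMod N → ℂ) (((((0 : ℕ) : ℤ) + N * k : ℤ)) : ZMod N) =
        quadraticPhase 1 a b 0 0 k := by
      intro k
      rw [quadraticPhase_one, quadraticPhase]
      have hbR : (b : ℝ) ≠ 0 := by exact_mod_cast hb
      rw [show (((((0 : ℕ) : ℤ) + N * k : ℤ)) : ZMod N) = 0 by push_cast; simp, Pi.single_eq_same,
        mul_one]
      congr 1
      push_cast
      field_simp
      ring
    rw [residueSum_congr h1, Int.natAbs_mul, Int.natAbs_natCast, mul_comm N]
    have hper := quadraticPhase_periodic one_ne_zero hb hab 0 0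
    rw [one_mul] at hper
    rw [residueSum_extend _ _ hper, quadraticSum]
    congr 1
    exact residueSum_congr fun k => quadraticPhase_one a b k
  · intro i hi hi0
    have h0 : ∀ k : ℤ, quadraticPhase N a (N * b) d 0 ((i : ℤ) + N * k) *
        (Pi.single 0 1 : ZMod N → ℂ) ((((i : ℤ) + N * k : ℤ)) : ZMod N) = 0 := by
      intro k
      have : (((i : ℤ) + N * k : ℤ) : ZMod N) ≠ 0 := by
        push_cast
        simp only [ZMod.natCast_self, zero_mul, add_zero]
        rw [Ne, ZMod.natCast_eq_zero_iff]
        intro hdvd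
        exact hi0 (Nat.eq_zero_of_dvd_of_lt hdvd (Finset.mem_range.mp hi))
      rw [Pi.single_eq_of_ne this, mul_zero]
    rw [residueSum_congr h0]
    simp [residueSum]
  · intro h
    exact absurd (Finset.mem_range.mpr (Nat.pos_of_ne_zero hN)) h

/-- The unnormalized propagator of a matrix congruent to the identity acts on basis vectors as a
scalar. -/
lemma quadraticTransform_single {a b c d : ℤ} (hb : b ≠ 0) (hab : Even (a * b))
    (hcd : Even (c * d)) (hdet : a * d - b * c = 1) (ha1 : (N : ℤ) ∣ a - 1) (hb1 : (2 * N : ℤ) ∣ b)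
    (hc1 : (2 * N : ℤ) ∣ c) (hd1 : (N : ℤ) ∣ d - 1) (x Q : ℤ) :
    quadraticTransform N a b d (Pi.single (x : ZMod N) 1) Q =
      quadraticTransform N a b d (Pi.single 0 1) 0 * (Pi.single (x : ZMod N) 1 : ZMod N → ℂ) Q := by
  have hN : N ≠ 0 := NeZero.ne N
  have hNR : (N : ℝ) ≠ 0 := by exact_mod_cast hN
  have hper := quadraticTransform_periodic hN hb hab hcd hdet
  obtain ⟨b₀, hb₀⟩ := hb1
  obtain ⟨c₀, hc₀⟩ := hc1
  have hbR : (b : ℝ) = 2 * N * b₀ := by exact_mod_cast hb₀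
  have hcR : (c : ℝ) = 2 * N * c₀ := by exact_mod_cast hc₀
  by_cases hQx : (Q : ZMod N) = x
  · rw [hQx, Pi.single_eq_same, mul_one]
    have hNQ : (N : ℤ) ∣ Q - a * x := by
      rw [← ZMod.intCast_zmod_eq_zero_iff_dvd] at ha1 ⊢
      push_cast at ha1 ⊢
      rw [hQx]
      linear_combination -(x : ZMod N) * ha1
    rw [periodic_of_dvd (hper _) hNQ]
    have hperx : Function.Periodic (fun y : ℤ => quadraticPhase N a b d (a * x) y *
        (Pi.single (x : ZMod N) 1 : ZMod N → ℂ) (y : ZMod N)) ((N * b.natAbs : ℕ) : ℤ) := by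
      intro y
      simp only [quadraticPhase_periodic hN hb hab d (a * x) y]
      simp
    rw [quadraticTransform, ← residueSum_add hperx x, quadraticTransform]
    refine residueSum_congr fun y => ?_
    -- Diagonal entries agree: translation by $(x,0)$ moves the entry at $0$ to the one at $x$, with
    -- phase trivial because $2N\mid c$.
    have h := quadraticPhase_translate hN hb hdet 0 y x 0
    rw [mul_zero, add_zero, zero_add] at h
    rw [h, e_eq_one (a * c₀ * x ^ 2)]
    · rw [mul_one]
      congr 1
      push_cast
      simp [Pi.single_apply]
    · push_cast
      rw [hcR]
      field_simp
      ring
  · rw [Pi.single_eq_of_ne hQx, mul_zero]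
    -- Off the diagonal, translation by $(0,1)$ shifts $Q$ by $b$, a multiple of $N$, so the entry
    -- is unchanged and yet multiplied by $e((Qd-x)/N)$; it vanishes unless $Q\equiv x$.
    have hshift : quadraticTransform N a b d (Pi.single (x : ZMod N) 1) (Q + b) =
        quadraticTransform N a b d (Pi.single (x : ZMod N) 1) Q * e (((Q * d - x : ℤ) : ℝ) / N) := by
      rw [quadraticTransform, quadraticTransform, ← residueSum_mul_const]
      refine residueSum_congr fun y => ?_
      by_cases hy : (y : ZMod N) = x
      · have h := quadraticPhase_translate hN hb hdet Q y 0 1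
        rw [mul_zero, zero_add, mul_one, add_zero] at h
        rw [h]
        obtain ⟨k, hk⟩ : (N : ℤ) ∣ y - x := by
          rw [← ZMod.intCast_zmod_eq_zero_iff_dvd]
          push_cast
          rw [hy, sub_self]
        have hkR : (y : ℝ) - x = N * k := by exact_mod_cast hk
        rw [mul_right_comm]
        congr 1
        refine e_congr (b₀ * d - k) ?_
        push_cast
        rw [hbR]
        field_simp
        linear_combination -2 * hkR
      · rw [Pi.single_eq_of_ne hy, mul_zero, mul_zero, zero_mul]
    rw [periodic_of_dvd (hper _) (y := Q) ⟨2 * b₀, by linear_combination hb₀⟩] at hshift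
    by_contra hne
    have h1 : e (((Q * d - x : ℤ) : ℝ) / N) = 1 := by
      apply mul_left_cancel₀ hne
      rw [← hshift, mul_one]
    obtain ⟨k, hk⟩ := (e_eq_one_iff _).mp h1
    rw [div_eq_iff hNR] at hk
    have hk' : Q * d - x = k * N := by exact_mod_cast hk
    apply hQx
    have h2 := congrArg (Int.cast : ℤ → ZMod N) hk'
    rw [← ZMod.intCast_zmod_eq_zero_iff_dvd] at hd1
    push_cast at h2 hd1
    simp only [ZMod.natCast_self, mul_zero] at h2
    linear_combination h2 - (Q : ZMod N) * hd1

lemma quadraticTransform_of_congr_one {a b c d : ℤ} (hb : b ≠ 0) (hab : Even (a * b))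
    (hcd : Even (c * d)) (hdet : a * d - b * c = 1) (ha1 : (N : ℤ) ∣ a - 1) (hb1 : (2 * N : ℤ) ∣ b)
    (hc1 : (2 * N : ℤ) ∣ c) (hd1 : (N : ℤ) ∣ d - 1) (Φ : ZMod N → ℂ) (Q : ℤ) :
    quadraticTransform N a b d Φ Q =
      quadraticTransform N a b d (Pi.single 0 1) 0 * Φ (Q : ZMod N) := by
  have hdecomp : quadraticTransform N a b d Φ Q =
      ∑ x : ZMod N, Φ x * quadraticTransform N a b d (Pi.single x 1) Q := by
    simp only [quadraticTransform, ← residueSum_const_mul]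
    simp only [residueSum]
    rw [Finset.sum_comm]
    refine Finset.sum_congr rfl fun y _ => ?_
    rw [Finset.sum_eq_single ((y : ℤ) : ZMod N)]
    · rw [Pi.single_eq_same]
      ring
    · intro x _ hx
      rw [Pi.single_eq_of_ne hx.symm, mul_zero, mul_zero]
    · intro h
      exact absurd (Finset.mem_univ _) h
  rw [hdecomp, Finset.sum_eq_single (Q : ZMod N)]
  · rw [quadraticTransform_single hb hab hcd hdet ha1 hb1 hc1 hd1, Pi.single_eq_same]
    ring
  · intro x _ hx
    obtain ⟨x, rfl⟩ := ZMod.intCast_surjective x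
    rw [quadraticTransform_single hb hab hcd hdet ha1 hb1 hc1 hd1, Pi.single_eq_of_ne hx.symm]
    ring
  · intro h
    exact absurd (Finset.mem_univ _) h

/-- The scalar is $h(a,b)/\sqrt{N|b|}$ times the transform at $0$. Writing $b=Nb'$ splits $(N/|a|)$
off $h(a,Nb')$, and $h(a,b')$ cancels the Gauss sum for $(a,b')$. -/
theorem propagator_of_congr_one {A : thetaGroup ℤ}
    (hA : ∀ i j : Fin 2, A.1 i j ≡ (1 : Matrix (Fin 2) (Fin 2) ℤ) i j [ZMOD (4 * N : ℤ)]) :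
    propagator N A =
      (jacobiSym N (A.1 0 0).natAbs : ℂ) • (LinearMap.id : Hilb N →ₗ[ℂ] Hilb N) := by
  have hN : N ≠ 0 := NeZero.ne N
  have hNR : (N : ℝ) ≠ 0 := by exact_mod_cast hN
  have hNpos : 0 < N := NeZero.pos N
  have hab := even_row_zero A
  have hcd := even_row_one A
  have hdet := det_eq_one A
  have ha := (hA 0 0).symm.dvd
  have hb := (hA 0 1).symm.dvd
  have hc := (hA 1 0).symm.dvd
  have hd := (hA 1 1).symm.dvd
  have hJ := jacobiSym_of_modEq_one (hA 0 0)
  simp only [Matrix.one_apply_eq, Matrix.one_apply_ne (show (0 : Fin 2) ≠ 1 by decide),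
    Matrix.one_apply_ne (show (1 : Fin 2) ≠ 0 by decide), sub_zero] at ha hb hc hd hJ
  refine LinearMap.ext fun Φ => ?_
  ext Q
  obtain ⟨q, rfl⟩ := ZMod.intCast_surjective Q
  rw [propagator_apply, LinearMap.smul_apply, LinearMap.id_apply, PiLp.smul_apply, smul_eq_mul]
  generalize A.1 0 0 = a at *
  generalize A.1 0 1 = b at *
  generalize A.1 1 0 = c at *
  generalize A.1 1 1 = d at *
  obtain ⟨a₁, ha₁⟩ := ha
  obtain ⟨b₁, hb₁⟩ := hb
  obtain ⟨c₁, hc₁⟩ := hc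
  obtain ⟨d₁, hd₁⟩ := hd
  rcases eq_or_ne b 0 with hb0 | hb0
  · have ha1 : a = 1 := by
      have had : a * d = 1 := by rw [hb0] at hdet; linarith
      rcases Int.mul_eq_one_iff_eq_one_or_neg_one.mp had with h | h
      · exact h.1
      · exfalso
        rw [h.1] at ha₁
        have : (4 : ℤ) ∣ -2 := ⟨N * a₁, by linarith⟩
        omega
    rw [hJ, hb0, ha1, propagatorFun_zero_intCast _ ⟨2 * N * c₁, by linarith⟩,
      e_eq_one (2 * c₁ * q ^ 2)]
    · simp
    · rw [hc₁]
      push_cast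
      field_simp
      ring
  · have hodd : ¬ Even a := by
      rw [Int.not_even_iff_odd]
      exact ⟨2 * N * a₁, by linarith⟩
    set b' := 4 * b₁ with hb'
    have hbN : b = N * b' := by rw [hb']; linarith
    have hb'0 : b' ≠ 0 := by
      rintro h
      rw [h, mul_zero] at hbN
      exact hb0 hbN
    have hab' : Even (a * b') := Even.mul_left ⟨2 * b₁, by rw [hb']; ring⟩ a
    have hcop' : IsCoprime a b' := by
      have h := isCoprime_of_det hdet
      rw [hbN] at h
      exact h.of_mul_right_right
    rw [propagatorFun_intCast hb0 hab hcd hdet,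
      quadraticTransform_of_congr_one hb0 hab hcd hdet ⟨4 * a₁, by linarith⟩
        ⟨2 * b₁, by linarith⟩ ⟨2 * c₁, by linarith⟩ ⟨4 * d₁, by linarith⟩,
      ← mul_assoc]
    congr 1
    rw [hbN, quadraticTransform_single_zero hb'0 hab', hPhase_mul_level hodd]
    have hG := hPhase_mul_quadraticSum hb'0 hab' hcop'
    have hsq : Real.sqrt (N * (N * b').natAbs) = N * Real.sqrt b'.natAbs := by
      rw [Int.natAbs_mul, Int.natAbs_natCast, Nat.cast_mul, ← mul_assoc,
        Real.sqrt_mul (by positivity), Real.sqrt_mul_self (by positivity)]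
    have hs : (Real.sqrt b'.natAbs : ℂ) ≠ 0 := by
      have : 0 < b'.natAbs := by omega
      exact_mod_cast (Real.sqrt_pos.mpr (by exact_mod_cast this)).ne'
    have hNC : (N : ℂ) ≠ 0 := by exact_mod_cast hN
    rw [hsq]
    push_cast
    field_simp
    linear_combination (jacobiSym N a.natAbs : ℂ) * hG

end Identity

end CatMap

/-! ### Descent to $\Gamma_\theta(4N)$. -/

theorem corollary1 (N : ℕ) [NeZero N] :
    -- `U_N(A)` depends only on the reduction of `A` modulo `4N`
    (∀ A B : CatMap.thetaGroup ℤ,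
      (∀ i j : Fin 2, A.1 i j ≡ B.1 i j [ZMOD (4 * N : ℤ)]) →
        CatMap.propagator N A = CatMap.propagator N B) ∧
    -- the propagators define a (unique) unitary representation of `Γ_θ(4N)`
    (∃! ρ : CatMap.thetaGroup (ZMod (4 * N)) →* (CatMap.Hilb N ≃ₗᵢ[ℂ] CatMap.Hilb N),
      ∀ (A : CatMap.thetaGroup ℤ) (Φ : CatMap.Hilb N),
        ρ (CatMap.thetaReduction N A) Φ = CatMap.propagator N A Φ) ∧
    -- the phase of a matrix congruent to the identity is the Jacobi symbol `(N / |a|) = 1`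
    (∀ A : CatMap.thetaGroup ℤ,
      (∀ i j : Fin 2, A.1 i j ≡ (1 : Matrix (Fin 2) (Fin 2) ℤ) i j [ZMOD (4 * N : ℤ)]) →
        CatMap.propagator N A =
            (jacobiSym N (A.1 0 0).natAbs : ℂ) • (LinearMap.id : CatMap.Hilb N →ₗ[ℂ] CatMap.Hilb N) ∧
          jacobiSym N (A.1 0 0).natAbs = 1) := by
  have hone : ∀ A : CatMap.thetaGroup ℤ,
      (∀ i j : Fin 2, A.1 i j ≡ (1 : Matrix (Fin 2) (Fin 2) ℤ) i j [ZMOD (4 * N : ℤ)]) →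
      jacobiSym N (A.1 0 0).natAbs = 1 := fun A hA => CatMap.jacobiSym_of_modEq_one (hA 0 0)
  -- Dependence on $A$ modulo $4N$ only is reduced, through the homomorphism property, to triviality
  -- on matrices congruent to the identity.
  have hker : (CatMap.thetaReduction N).ker ≤ (CatMap.propagatorHom N).ker := by
    intro A hA
    rw [MonoidHom.mem_ker, ← map_one (CatMap.thetaReduction N), CatMap.thetaReduction_eq_iff] at hA
    rw [MonoidHom.mem_ker]
    ext Φ : 1
    rw [CatMap.propagatorHom_apply, CatMap.propagator_of_congr_one hA, hone A hA]
    simp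
  have hsurj := CatMap.thetaReduction_surjective N
  set ρ := MonoidHom.liftOfRightInverse (CatMap.thetaReduction N) _ (Function.rightInverse_surjInv hsurj)
    ⟨CatMap.propagatorHom N, hker⟩ with hρ
  have hρA : ∀ A, ρ (CatMap.thetaReduction N A) = CatMap.propagatorHom N A := fun A =>
    MonoidHom.liftOfRightInverse_comp_apply _ _ _ _ A
  refine ⟨fun A B hAB => ?_, ⟨ρ, fun A Φ => ?_, fun ρ' hρ' => ?_⟩,
    fun A hA => ⟨CatMap.propagator_of_congr_one hA, hone A hA⟩⟩
  · refine LinearMap.ext fun Φ => ?_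
    rw [← CatMap.propagatorHom_apply, ← CatMap.propagatorHom_apply, ← hρA, ← hρA,
      (CatMap.thetaReduction_eq_iff N A B).mpr hAB]
  · rw [hρA, CatMap.propagatorHom_apply]
  · refine MonoidHom.ext fun X => ?_
    obtain ⟨A, rfl⟩ := hsurj X
    ext Φ : 1
    rw [hρ' A Φ, hρA, CatMap.propagatorHom_apply]
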